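/- Let $R_0>0$, $q\in(1/2,1)$, $A\in\mathbb{R}$, and let $g=(g_{ij})$ be a $C^2$ Riemannian metric on the exterior region $\{x\in\mathbb{R}^3: |x|>R_0\}$ (for example, an asymptotically flat metric written in its asymptotically flat chart). Write $r=|x|$ and $\alpha=x_1/r$. Suppose that the scalar curvature $R_g$ vanishes identically and that, as $r\to\infty$, $$g_{ij}=\Big(1+\frac{A}{r}\Big)\delta_{ij}+\frac{\alpha}{r}\Big(\frac{x_ix_j}{r^2}-\frac12\delta_{ij}\Big)+O_2(r^{-1-q}),\qquad i,j=1,2,3,$$ where $f=O_2(r^{-a})$ means that for large $r$ the partial derivatives of $f$ of order $k=0,1,2$ are bounded by $C r^{-a-k}$ for some constant $C$. Then the energy $$E=\frac1{16\pi}\lim_{\rho\to\infty}\int_{r=\rho}\sum_{i,j}(g_{ij,i}-g_{ii,j})\frac{x_j}{r}\,dS$$ exists as a real number, and if $E\neq0$, then the first component of the center of mass, $$\mathbf{C}_1=\frac1{16\pi E}\lim_{\rho\to\infty}\int_{r=\rho}\Big[x_1\sum_{i,j}(g_{ij,i}-g_{ii,j})\frac{x_j}{r}-\sum_i\Big(g_{i1}\frac{x_i}{r}-g_{ii}\frac{x_1}{r}\Big)\Big]dS,$$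 is infinite; more precisely, $\frac{1}{16\pi E}$ times the surface integral over $\{r=\rho\}$ tends to $-\infty$ as $\rho\to\infty$, i.e. $\mathbf{C}_1=-\infty$. -/

import Mathlib

open Filter Topology MeasureTheory

noncomputable section

namespace AsymptoticallyFlat

/-- Euclidean three-space `ℝ³`; the coordinates `x₁, x₂, x₃` are `x 0, x 1, x 2`. -/
abbrev E3 : Type := EuclideanSpace ℝ (Fin 3)

/-- The partial derivative `∂f/∂xᵢ` at `x`. -/
def pd (i : Fin 3) (f : E3 → ℝ) (x : E3) : ℝ :=
  fderiv ℝ f x (EuclideanSpace.single i 1)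

/-- The Kronecker delta. -/
def kd (i j : Fin 3) : ℝ := if i = j then 1 else 0

/-- The exterior region `{x ∈ ℝ³ : |x| > R₀}`. -/
def exterior (R₀ : ℝ) : Set E3 := {x | R₀ < ‖x‖}

/-- `g` is the matrix of components `g i j` of a `C²` Riemannian metric on `Ω ⊆ ℝ³`.
Over `ℝ`, `Matrix.PosDef` includes symmetry. -/
structure IsRiemannianMetricOn (g : E3 → Matrix (Fin 3) (Fin 3) ℝ) (Ω : Set E3) : Prop where
  posDef : ∀ x ∈ Ω, (g x).PosDef
  contDiffOn : ∀ i j, ContDiffOn ℝ 2 (fun x => g x i j) Ω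

/-- The Christoffel symbol
`Γᵏᵢⱼ = ½ ∑ₗ gᵏˡ (∂ᵢ gⱼₗ + ∂ⱼ gᵢₗ - ∂ₗ gᵢⱼ)`. -/
def christoffel (g : E3 → Matrix (Fin 3) (Fin 3) ℝ) (k i j : Fin 3) (x : E3) : ℝ :=
  (1 / 2) * ∑ l, (g x)⁻¹ k l *
    (pd i (fun y => g y j l) x + pd j (fun y => g y i l) x - pd l (fun y => g y i j) x)

/-- The Ricci curvature
`Rᵢₖ = ∑ⱼ (∂ⱼ Γʲᵢₖ - ∂ᵢ Γʲⱼₖ) + ∑ⱼₘ (Γᵐᵢₖ Γʲⱼₘ - Γᵐⱼₖ Γʲᵢₘ)`. -/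
def ricci (g : E3 → Matrix (Fin 3) (Fin 3) ℝ) (i k : Fin 3) (x : E3) : ℝ :=
  ∑ j, (pd j (christoffel g j i k) x - pd i (christoffel g j j k) x) +
    ∑ j, ∑ m, (christoffel g m i k x * christoffel g j j m x -
      christoffel g m j k x * christoffel g j i m x)

/-- The scalar curvature `R_g = ∑ᵢₖ gⁱᵏ Rᵢₖ`. -/
def scalarCurvature (g : E3 → Matrix (Fin 3) (Fin 3) ℝ) (x : E3) : ℝ :=
  ∑ i, ∑ k, (g x)⁻¹ i k * ricci g i k x

/-- `f = O₂(r^{-a})`: for large `r = |x|`, the derivatives of `f` of order `0`, `1`, `2` are bounded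
by a constant times `r^{-a}`, `r^{-a-1}`, `r^{-a-2}` respectively. -/
def IsBigOTwo (f : E3 → ℝ) (a : ℝ) : Prop :=
  ∃ C R : ℝ, ∀ x : E3, R < ‖x‖ →
    |f x| ≤ C * ‖x‖ ^ (-a) ∧
    (∀ i, |pd i f x| ≤ C * ‖x‖ ^ (-a - 1)) ∧
    (∀ i j, |pd i (pd j f) x| ≤ C * ‖x‖ ^ (-a - 2))

/-- The tensor `σᵢⱼ = (α / r) (xᵢ xⱼ / r² - ½ δᵢⱼ)`. -/
def sigma (α : E3 → ℝ) (i j : Fin 3) (x : E3) : ℝ :=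
  α x / ‖x‖ * (x i * x j / ‖x‖ ^ 2 - (1 / 2) * kd i j)

/-- The asymptotics
`gᵢⱼ = (1 + A / r) δᵢⱼ + (α / r) (xᵢ xⱼ / r² - ½ δᵢⱼ) + O₂(r^{-1-q})`. -/
def HasAsymptotics (g : E3 → Matrix (Fin 3) (Fin 3) ℝ) (A : ℝ) (α : E3 → ℝ) (q : ℝ) : Prop :=
  ∀ i j, IsBigOTwo
    (fun x => g x i j - ((1 + A / ‖x‖) * kd i j + sigma α i j x)) (1 + q)

/-- The surface integral `∫_{r = ρ} F dS`, for `ρ > 0`, over the Euclidean sphere of radius `ρ`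
with its standard surface measure, written as `ρ² ∫_{S²} F(ρ ω) dω`
(`volume.toSphere` is the standard measure on the unit sphere, of total mass `4π`). -/
def sphereIntegral (F : E3 → ℝ) (ρ : ℝ) : ℝ :=
  ρ ^ 2 * ∫ ω : Metric.sphere (0 : E3) 1, F (ρ • (ω : E3)) ∂((volume : Measure E3).toSphere)

/-- `∑ᵢⱼ (g_{ij,i} - g_{ii,j}) xⱼ / r`. -/
def energyDensity (g : E3 → Matrix (Fin 3) (Fin 3) ℝ) (x : E3) : ℝ :=
  ∑ i, ∑ j, (pd i (fun y => g y i j) x - pd j (fun y => g y i i) x) * (x j / ‖x‖)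

/-- `x_l ∑ᵢⱼ (g_{ij,i} - g_{ii,j}) xⱼ / r - ∑ᵢ (g_{il} xᵢ / r - g_{ii} x_l / r)`. -/
def centerDensity (g : E3 → Matrix (Fin 3) (Fin 3) ℝ) (l : Fin 3) (x : E3) : ℝ :=
  x l * energyDensity g x - ∑ i, (g x i l * (x i / ‖x‖) - g x i i * (x l / ‖x‖))

/-- The energy of `g` exists and is the real number `E`:
`E = (1 / 16π) lim_{ρ → ∞} ∫_{r = ρ} ∑ᵢⱼ (g_{ij,i} - g_{ii,j}) xⱼ / r dS`. -/
def HasEnergy (g : E3 → Matrix (Fin 3) (Fin 3) ℝ) (E : ℝ) : Prop :=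
  Tendsto (fun ρ : ℝ => 1 / (16 * Real.pi) * sphereIntegral (energyDensity g) ρ) atTop (𝓝 E)

/-- For a metric `g` of energy `E ≠ 0`, the `l`-th component of the center of mass exists in the
extended reals and is equal to `c`: `c` is the limit as `ρ → ∞` of `1 / (16πE)` times the surface
integral of `centerDensity g l` over `{r = ρ}`. -/
def HasCenterOfMass (g : E3 → Matrix (Fin 3) (Fin 3) ℝ) (E : ℝ) (l : Fin 3) (c : EReal) : Prop :=
  Tendsto
    (fun ρ : ℝ => ((1 / (16 * Real.pi * E) * sphereIntegral (centerDensity g l) ρ : ℝ) : EReal))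
    atTop (𝓝 c)

end AsymptoticallyFlat

end

/-! The surface integral for the center of mass is the flux of a field (`centerField`) whose
divergence is `x₁` times the linearised scalar curvature `L = ∑ (∂ᵢ∂ⱼ gᵢⱼ - ∂ⱼ∂ⱼ gᵢᵢ)`
(`div_centerField`). Hence the derivative of the surface integral in the radius `ρ` is `∫_{r=ρ} x₁ L
dS` (`hasDerivAt_flux`), and only the part of `L` that is odd under `x ↦ -x` contributes.

Since the scalar curvature vanishes, `L = -Q + O(r^{-4-q})`, where `Q` consists of the quadratic
terms of the curvature evaluated on the leading part `(A/r) δ + σ` of `g - δ`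
(`MetricApprox.scalarCurvature`). Here `Q` is homogeneous of degree `-4`. As `1/r` is even and `σ`
is odd, the odd part of `Q` is the interaction of `A/r` with `σ`, which polarization evaluates to
`(3/2) A x₁ / r⁵` (`quadModel_model_sub_neg`). So the derivative is `-(3/2) A κ / ρ + O(ρ^{-1-q})`
with `κ = ∫ ω₁² dω > 0` (`exists_bound_deriv_center`), and the surface integral diverges
logarithmically.

The energy exists because the leading energy density is `2A/r²` plus an odd term, so `E` is a
positive multiple of `A` (`hasEnergy_of_asymptotics`). After division by `E` the sign of `A`
cancels, leaving a function that behaves like a negative multiple of `log ρ`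
(`tendsto_atBot_of_deriv`). -/

noncomputable section

namespace AsymptoticallyFlat

/-! ### Invariance of the sphere measure under linear isometries -/

/-- The standard measure on the unit sphere of `ℝ³`. -/
abbrev sphereMeasure : Measure (Metric.sphere (0 : E3) 1) := (volume : Measure E3).toSphere

/-- The action of a linear isometry on the unit sphere. -/
def sphereMap (U : E3 ≃ₗᵢ[ℝ] E3) (ω : Metric.sphere (0 : E3) 1) : Metric.sphere (0 : E3) 1 :=
  ⟨U ω, by simp⟩

lemma continuous_sphereMap (U : E3 ≃ₗᵢ[ℝ] E3) : Continuous (sphereMap U) :=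
  (U.continuous.comp continuous_subtype_val).subtype_mk _

/-- The sphere measure of a set is a multiple of the volume of the cone `(0, 1) • s`. A linear
isometry carries cones to cones and preserves volume. -/
lemma measurePreserving_sphereMap (U : E3 ≃ₗᵢ[ℝ] E3) :
    MeasurePreserving (sphereMap U) sphereMeasure sphereMeasure := by
  refine ⟨(continuous_sphereMap U).measurable, ?_⟩
  ext s hs
  rw [Measure.map_apply (continuous_sphereMap U).measurable hs, Measure.toSphere_apply' _ hs,
    Measure.toSphere_apply' _ ((continuous_sphereMap U).measurable hs)]
  congr 1
  conv_rhs => rw [← U.measurePreserving.measure_preimage_equiv (f := U.toMeasurableEquiv)]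
  congr 1
  ext x
  simp only [Set.mem_smul, Set.mem_image, Set.mem_preimage, Subtype.exists, exists_and_right,
    exists_eq_right]
  constructor
  · rintro ⟨r, hr, y, ⟨hy, hys⟩, rfl⟩
    exact ⟨r, hr, U y, ⟨by simpa using hy, hys⟩, (U.map_smul r y).symm⟩
  · rintro ⟨r, hr, y, ⟨hy, hys⟩, hxy⟩
    refine ⟨r, hr, U.symm y, ⟨by simpa using hy, ?_⟩, ?_⟩
    · simpa [sphereMap] using hys
    · apply U.injective
      rw [U.map_smul, U.apply_symm_apply]
      exact hxy

lemma integral_sphereMap (U : E3 ≃ₗᵢ[ℝ] E3) (f : E3 → ℝ) :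
    ∫ ω, f (U (ω : E3)) ∂sphereMeasure = ∫ ω, f (ω : E3) ∂sphereMeasure := by
  have hemb : MeasurableEmbedding (sphereMap U) := by
    refine Continuous.measurableEmbedding (continuous_sphereMap U) fun a b h => ?_
    have : U (a : E3) = U (b : E3) := congrArg Subtype.val h
    exact Subtype.ext (U.injective this)
  exact (measurePreserving_sphereMap U).integral_comp hemb fun ω => f (ω : E3)

lemma integral_sphere_eq_zero_of_odd {f : E3 → ℝ} (hf : ∀ x, f (-x) = -f x) :
    ∫ ω, f (ω : E3) ∂sphereMeasure = 0 := by
  have h := integral_sphereMap (LinearIsometryEquiv.neg ℝ) f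
  simp only [LinearIsometryEquiv.coe_neg, hf, integral_neg] at h
  linarith

/-! ### Rotation fields and the divergence theorem on spheres -/

/-- The linear map `x ↦ x + (c - 1) (x_i e_i + x_j e_j) + s (x_i e_j - x_j e_i)`. -/
def rotationMap (i j : Fin 3) (c s : ℝ) : E3 →ₗ[ℝ] E3 where
  toFun x := x + (c - 1) • (x i • EuclideanSpace.single i 1 + x j • EuclideanSpace.single j 1)
    + s • (x i • EuclideanSpace.single j 1 - x j • EuclideanSpace.single i (1 : ℝ))
  map_add' x y := by
    simp only [PiLp.add_apply]; module
  map_smul' a x := by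
    simp only [PiLp.smul_apply, smul_eq_mul, RingHom.id_apply]; module

lemma norm_rotationMap {i j : Fin 3} (hij : i ≠ j) (t : ℝ) (x : E3) :
    ‖rotationMap i j (Real.cos t) (Real.sin t) x‖ = ‖x‖ := by
  have h := Real.sin_sq_add_cos_sq t
  rw [EuclideanSpace.norm_eq, EuclideanSpace.norm_eq]
  congr 1
  fin_cases i <;> fin_cases j <;> first
    | exact absurd rfl hij
    | (simp [rotationMap, Fin.sum_univ_three]
       first
        | linear_combination (x 0 ^ 2 + x 1 ^ 2) * h
        | linear_combination (x 0 ^ 2 + x 2 ^ 2) * h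
        | linear_combination (x 1 ^ 2 + x 2 ^ 2) * h)

/-- Rotation by the angle `t` in the `(x_i, x_j)`-plane. -/
def rotation {i j : Fin 3} (hij : i ≠ j) (t : ℝ) : E3 ≃ₗᵢ[ℝ] E3 :=
  LinearIsometry.toLinearIsometryEquiv
    ⟨rotationMap i j (Real.cos t) (Real.sin t), norm_rotationMap hij t⟩ rfl

lemma rotation_apply {i j : Fin 3} (hij : i ≠ j) (t : ℝ) (x : E3) :
    rotation hij t x =
      x + (Real.cos t - 1) • (x i • EuclideanSpace.single i 1 + x j • EuclideanSpace.single j 1)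
    + Real.sin t • (x i • EuclideanSpace.single j 1 - x j • EuclideanSpace.single i (1 : ℝ)) := rfl

/-- Differentiation under the integral sign over a compact space. -/
lemma hasDerivAt_integral_of_continuousOn {K : Type*} [TopologicalSpace K] [CompactSpace K]
    [MeasurableSpace K] [BorelSpace K] {μ : Measure K} [IsFiniteMeasure μ]
    [SecondCountableTopology K]
    {F F' : ℝ → K → ℝ} {t₀ ε : ℝ} (hε : 0 < ε)
    (hF : ∀ t ∈ Metric.closedBall t₀ ε, Continuous (F t))
    (hF' : ContinuousOn (fun p : ℝ × K => F' p.1 p.2) (Metric.closedBall t₀ ε ×ˢ Set.univ))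
    (hd : ∀ t ∈ Metric.closedBall t₀ ε, ∀ k, HasDerivAt (fun t => F t k) (F' t k) t) :
    HasDerivAt (fun t => ∫ k, F t k ∂μ) (∫ k, F' t₀ k ∂μ) t₀ := by
  obtain ⟨C, hC⟩ := ((isCompact_closedBall t₀ ε).prod isCompact_univ).exists_bound_of_continuousOn
    hF'
  have h0 : t₀ ∈ Metric.closedBall t₀ ε := Metric.mem_closedBall_self hε.le
  have hint : ∀ {f : K → ℝ}, Continuous f → Integrable f μ := fun hf =>
    (BoundedContinuousFunction.mkOfCompact ⟨_, hf⟩).integrable μ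
  have hF0 : Continuous (F' t₀) := by
    rw [← continuousOn_univ]
    exact hF'.comp (f := fun k => (t₀, k)) (by fun_prop) fun k _ => ⟨h0, trivial⟩
  refine (hasDerivAt_integral_of_dominated_loc_of_deriv_le (bound := fun _ => C)
    (Metric.closedBall_mem_nhds t₀ hε) ?_ (hint (hF _ h0)) (hint hF0).aestronglyMeasurable
    ?_ (integrable_const _) ?_).2
  · filter_upwards [Metric.closedBall_mem_nhds t₀ hε] with t ht
    exact (hint (hF t ht)).aestronglyMeasurable
  · exact Eventually.of_forall fun k t ht => hC (t, k) ⟨ht, trivial⟩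
  · exact Eventually.of_forall fun k t ht => hd t ht k

lemma isOpen_exterior (R₀ : ℝ) : IsOpen (exterior R₀) :=
  isOpen_lt continuous_const continuous_norm

lemma smul_mem_exterior_of_norm_eq_one {R₀ ρ : ℝ} (hR₀ : 0 < R₀) (hρ : R₀ < ρ) {x : E3}
    (hx : ‖x‖ = 1) : ρ • x ∈ exterior R₀ := by
  simp [exterior, norm_smul, abs_of_pos (hR₀.trans hρ), hρ, hx]

lemma smul_mem_exterior {R₀ ρ : ℝ} (hR₀ : 0 < R₀) (hρ : R₀ < ρ) (ω : Metric.sphere (0 : E3) 1) :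
    ρ • (ω : E3) ∈ exterior R₀ := by
  simp [exterior, norm_smul, abs_of_pos (hR₀.trans hρ), hρ]

lemma fderiv_apply_eq_sum_pd (f : E3 → ℝ) (x v : E3) :
    fderiv ℝ f x v = ∑ k, v k * pd k f x := by
  have hv : v = ∑ k, v k • EuclideanSpace.single k (1 : ℝ) := by
    ext i; simp [Finset.sum_apply, Pi.single_apply]
  conv_lhs => rw [hv]
  simp [pd, map_sum]

lemma continuousOn_pd {f : E3 → ℝ} {R₀ : ℝ} (hf : ContDiffOn ℝ 1 f (exterior R₀))
    (k : Fin 3) : ContinuousOn (pd k f) (exterior R₀) :=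
  (hf.continuousOn_fderiv_of_isOpen (isOpen_exterior R₀) le_rfl).clm_apply continuousOn_const

lemma integrable_sphere_comp {f : E3 → ℝ} {R₀ ρ : ℝ} (hR₀ : 0 < R₀) (hρ : R₀ < ρ)
    (hf : ContinuousOn f (exterior R₀)) :
    Integrable (fun ω : Metric.sphere (0 : E3) 1 => f (ρ • (ω : E3))) sphereMeasure := by
  have : Continuous (fun ω : Metric.sphere (0 : E3) 1 => f (ρ • (ω : E3))) :=
    hf.comp_continuous (by fun_prop) fun ω => smul_mem_exterior hR₀ hρ ω
  exact (BoundedContinuousFunction.mkOfCompact ⟨_, this⟩).integrable _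

/-- The velocity `d/dt (rotation t x)`. -/
def rotationVelocity (i j : Fin 3) (t : ℝ) (x : E3) : E3 :=
  (-Real.sin t) • (x i • EuclideanSpace.single i 1 + x j • EuclideanSpace.single j 1)
    + Real.cos t • (x i • EuclideanSpace.single j 1 - x j • EuclideanSpace.single i (1 : ℝ))

lemma hasDerivAt_rotation {i j : Fin 3} (hij : i ≠ j) (t : ℝ) (x : E3) :
    HasDerivAt (fun t => rotation hij t x) (rotationVelocity i j t x) t := by
  simp only [rotation_apply]
  exact ((((Real.hasDerivAt_cos t).sub_const 1).smul_const _).const_add x).add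
      ((Real.hasDerivAt_sin t).smul_const _)

lemma continuous_rotation {i j : Fin 3} (hij : i ≠ j) :
    Continuous fun p : ℝ × E3 => rotation hij p.1 p.2 := by
  simp only [rotation_apply]
  fun_prop

lemma continuous_rotationVelocity (i j : Fin 3) :
    Continuous fun p : ℝ × E3 => rotationVelocity i j p.1 p.2 := by
  unfold rotationVelocity
  fun_prop

/-- The rotation fields integrate to zero over spheres. -/
lemma integral_rotationField {f : E3 → ℝ} {R₀ ρ : ℝ} (hR₀ : 0 < R₀) (hρ : R₀ < ρ)
    (hf : ContDiffOn ℝ 1 f (exterior R₀)) (i j : Fin 3) :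
    ∫ ω : Metric.sphere (0 : E3) 1, ((ω : E3) i * pd j f (ρ • (ω : E3)) -
      (ω : E3) j * pd i f (ρ • (ω : E3))) ∂sphereMeasure = 0 := by
  rcases eq_or_ne i j with rfl | hij
  · simp
  have hρ0 : 0 < ρ := hR₀.trans hρ
  have hmem : ∀ (t : ℝ) (ω : Metric.sphere (0 : E3) 1),
      ρ • rotation hij t (ω : E3) ∈ exterior R₀ := fun t ω =>
    smul_mem_exterior_of_norm_eq_one hR₀ hρ (by simp)
  -- Rotation invariance makes the averaged function constant in `t`; its derivative at `t = 0`,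
  -- taken under the integral sign, is `ρ` times the integral in question.
  have hconst : ∀ t, ∫ ω, f (ρ • rotation hij t (ω : E3)) ∂sphereMeasure =
      ∫ ω, f (ρ • (ω : E3)) ∂sphereMeasure := fun t =>
    integral_sphereMap (rotation hij t) fun x => f (ρ • x)
  have hincl : Continuous fun p : ℝ × Metric.sphere (0 : E3) 1 => (p.1, (p.2 : E3)) := by fun_prop
  have hrot : Continuous fun p : ℝ × Metric.sphere (0 : E3) 1 => ρ • rotation hij p.1 (p.2 : E3) :=
    ((continuous_rotation hij).comp hincl).const_smul ρ
  have hvel : Continuous fun p : ℝ × Metric.sphere (0 : E3) 1 =>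
      ρ • rotationVelocity i j p.1 (p.2 : E3) :=
    ((continuous_rotationVelocity i j).comp hincl).const_smul ρ
  have hfd := hf.continuousOn_fderiv_of_isOpen (isOpen_exterior R₀) le_rfl
  have hc : ContinuousOn (fun p : ℝ × Metric.sphere (0 : E3) 1 =>
      fderiv ℝ f (ρ • rotation hij p.1 (p.2 : E3)) (ρ • rotationVelocity i j p.1 (p.2 : E3)))
      (Metric.closedBall 0 1 ×ˢ Set.univ) :=
    (hfd.comp hrot.continuousOn fun p _ => hmem p.1 p.2).clm_apply hvel.continuousOn
  have hd : ∀ (t : ℝ) (ω : Metric.sphere (0 : E3) 1),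
      HasDerivAt (fun t => f (ρ • rotation hij t (ω : E3)))
        (fderiv ℝ f (ρ • rotation hij t (ω : E3)) (ρ • rotationVelocity i j t ω)) t := by
    intro t ω
    have hdf : HasFDerivAt f (fderiv ℝ f (ρ • rotation hij t (ω : E3)))
        (ρ • rotation hij t (ω : E3)) :=
      ((hf.contDiffAt ((isOpen_exterior R₀).mem_nhds (hmem t ω))).differentiableAt
          one_ne_zero).hasFDerivAt
    exact hdf.comp_hasDerivAt t ((hasDerivAt_rotation hij t (ω : E3)).const_smul ρ)
  have hcont : ∀ t, Continuous fun ω : Metric.sphere (0 : E3) 1 =>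
      f (ρ • rotation hij t (ω : E3)) := fun t =>
    hf.continuousOn.comp_continuous (((rotation hij t).continuous.comp
      continuous_subtype_val).const_smul ρ) (hmem t)
  have hder : HasDerivAt (fun t => ∫ ω, f (ρ • rotation hij t (ω : E3)) ∂sphereMeasure)
      (∫ ω, fderiv ℝ f (ρ • rotation hij 0 (ω : E3)) (ρ • rotationVelocity i j 0 ω)
        ∂sphereMeasure) 0 :=
    hasDerivAt_integral_of_continuousOn
      (F := fun t (ω : Metric.sphere (0 : E3) 1) => f (ρ • rotation hij t (ω : E3)))
      (F' := fun t (ω : Metric.sphere (0 : E3) 1) =>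
        fderiv ℝ f (ρ • rotation hij t (ω : E3)) (ρ • rotationVelocity i j t ω))
      one_pos (fun t _ => hcont t) hc (fun t _ ω => hd t ω)
  simp only [hconst] at hder
  have h0 := hder.unique (hasDerivAt_const _ _)
  have h1 : ∀ ω : Metric.sphere (0 : E3) 1,
      fderiv ℝ f (ρ • rotation hij 0 (ω : E3)) (ρ • rotationVelocity i j 0 ω) =
      ρ * ((ω : E3) i * pd j f (ρ • (ω : E3)) - (ω : E3) j * pd i f (ρ • (ω : E3))) := by
    intro ω
    simp [rotation_apply, rotationVelocity, pd]
  simp only [h1, integral_const_mul] at h0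
  exact (mul_eq_zero.1 h0).resolve_left hρ0.ne'

/-- The divergence theorem for spheres in differentiated form. -/
lemma hasDerivAt_flux {V : Fin 3 → E3 → ℝ} {R₀ ρ : ℝ} (hR₀ : 0 < R₀) (hρ : R₀ < ρ)
    (hV : ∀ j, ContDiffOn ℝ 1 (V j) (exterior R₀)) :
    HasDerivAt (sphereIntegral fun x => ∑ j, V j x * (x j / ‖x‖))
      (sphereIntegral (fun x => ∑ j, pd j (V j) x) ρ) ρ := by
  have hρ0 : 0 < ρ := hR₀.trans hρ
  let I : ℝ → ℝ := fun r => ∫ ω : Metric.sphere (0 : E3) 1,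
    ∑ j, V j (r • (ω : E3)) * (ω : E3) j ∂sphereMeasure
  -- In polar coordinates the flux is `r² I(r)`, with derivative `2 ρ I + ρ² I'`. Comparing this
  -- with the integral of the divergence requires an integration by parts on the sphere, supplied by
  -- `hrot` and `hsum`.
  have hS : (sphereIntegral fun x => ∑ j, V j x * (x j / ‖x‖)) =ᶠ[𝓝 ρ] fun r => r ^ 2 * I r := by
    filter_upwards [lt_mem_nhds hρ0] with r hr
    simp [sphereIntegral, I, norm_smul, abs_of_pos hr, hr.ne']
  obtain ⟨ε, hε, hball⟩ := Metric.nhds_basis_closedBall.mem_iff.1 (lt_mem_nhds hρ)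
  have hball' : ∀ r ∈ Metric.closedBall ρ ε, R₀ < r := fun r hr => hball hr
  have hsm : Continuous fun p : ℝ × Metric.sphere (0 : E3) 1 => p.1 • (p.2 : E3) := by fun_prop
  have hI : HasDerivAt I (∫ ω : Metric.sphere (0 : E3) 1,
      ∑ j, fderiv ℝ (V j) (ρ • (ω : E3)) (ω : E3) * (ω : E3) j ∂sphereMeasure) ρ := by
    refine hasDerivAt_integral_of_continuousOn hε ?_
      (F' := fun r (ω : Metric.sphere (0 : E3) 1) =>
        ∑ j, fderiv ℝ (V j) (r • (ω : E3)) (ω : E3) * (ω : E3) j) ?_ ?_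
    · intro r hr
      refine continuous_finsetSum _ fun j _ => Continuous.mul ?_ (by fun_prop)
      exact (hV j).continuousOn.comp_continuous (by fun_prop)
        fun ω => smul_mem_exterior hR₀ (hball' r hr) ω
    · refine continuousOn_finsetSum _ fun j _ => ContinuousOn.mul ?_ (by fun_prop)
      refine ContinuousOn.clm_apply (((hV j).continuousOn_fderiv_of_isOpen (isOpen_exterior R₀)
        le_rfl).comp hsm.continuousOn fun p hp => ?_) (by fun_prop)
      exact smul_mem_exterior hR₀ (hball' _ hp.1) p.2
    · intro r hr ω
      refine HasDerivAt.fun_sum fun j _ => HasDerivAt.mul_const ?_ _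
      have hdf : HasFDerivAt (V j) (fderiv ℝ (V j) _) (r • (ω : E3)) :=
        (((hV j).contDiffAt ((isOpen_exterior R₀).mem_nhds
          (smul_mem_exterior hR₀ (hball' r hr) ω))).differentiableAt one_ne_zero).hasFDerivAt
      have h2 : HasDerivAt (fun r : ℝ => r • (ω : E3)) (ω : E3) r := by
        simpa using (hasDerivAt_id r).smul_const (ω : E3)
      exact hdf.comp_hasDerivAt r h2
  have hmem : ∀ ω : Metric.sphere (0 : E3) 1, ρ • (ω : E3) ∈ exterior R₀ :=
    smul_mem_exterior hR₀ hρ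
  have hVc : ∀ j, Continuous fun ω : Metric.sphere (0 : E3) 1 => V j (ρ • (ω : E3)) := fun j =>
    (hV j).continuousOn.comp_continuous (by fun_prop) hmem
  have hpc : ∀ k j, Continuous fun ω : Metric.sphere (0 : E3) 1 => pd k (V j) (ρ • (ω : E3)) :=
    fun k j => (continuousOn_pd (hV j) k).comp_continuous (by fun_prop) hmem
  have hint : ∀ {f : Metric.sphere (0 : E3) 1 → ℝ}, Continuous f → Integrable f sphereMeasure :=
    fun hf => (BoundedContinuousFunction.mkOfCompact ⟨_, hf⟩).integrable _
  -- The rotation field in the `(i, j)`-plane is applied to `xᵢ Vⱼ`. Summed over `i, j` with `|ω| =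
  -- 1`, the integrand becomes `ρ div V - 2 V·ω - ρ (∂_ω V)·ω`, which is the identity wanted.
  have hrot : ∀ i j, ∫ ω : Metric.sphere (0 : E3) 1,
      ((ω : E3) i * (kd i j * V j (ρ • (ω : E3)) + ρ * (ω : E3) i * pd j (V j) (ρ • (ω : E3))) -
      (ω : E3) j * (V j (ρ • (ω : E3)) + ρ * (ω : E3) i * pd i (V j) (ρ • (ω : E3))))
      ∂sphereMeasure = 0 := by
    intro i j
    have hf : ContDiffOn ℝ 1 (fun x : E3 => x i * V j x) (exterior R₀) :=
      ContDiffOn.mul (by fun_prop) (hV j)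
    rw [← integral_rotationField hR₀ hρ hf i j]
    refine integral_congr_ae (Eventually.of_forall fun ω => ?_)
    have hVd : DifferentiableAt ℝ (V j) (ρ • (ω : E3)) :=
      ((hV j).contDiffAt ((isOpen_exterior R₀).mem_nhds (hmem ω))).differentiableAt one_ne_zero
    have hpd : ∀ k, pd k (fun x : E3 => x i * V j x) (ρ • (ω : E3)) =
        kd i k * V j (ρ • (ω : E3)) + ρ * (ω : E3) i * pd k (V j) (ρ • (ω : E3)) := by
      intro k
      have h1 : HasFDerivAt (fun x : E3 => x i) (EuclideanSpace.proj i : E3 →L[ℝ] ℝ)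
          (ρ • (ω : E3)) := (EuclideanSpace.proj i : E3 →L[ℝ] ℝ).hasFDerivAt
      rw [pd, (h1.fun_mul hVd.hasFDerivAt).fderiv]
      simp [pd, kd]
      ring
    simp only [hpd]
    simp [kd]
  have hsum : ∫ ω : Metric.sphere (0 : E3) 1,
      (ρ * ∑ j, pd j (V j) (ρ • (ω : E3)) - 2 * ∑ j, V j (ρ • (ω : E3)) * (ω : E3) j -
        ρ * ∑ j, fderiv ℝ (V j) (ρ • (ω : E3)) (ω : E3) * (ω : E3) j) ∂sphereMeasure = 0 := by
    have h0 : ∑ i, ∑ j, ∫ ω : Metric.sphere (0 : E3) 1,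
      ((ω : E3) i * (kd i j * V j (ρ • (ω : E3)) + ρ * (ω : E3) i * pd j (V j) (ρ • (ω : E3))) -
      (ω : E3) j * (V j (ρ • (ω : E3)) + ρ * (ω : E3) i * pd i (V j) (ρ • (ω : E3))))
      ∂sphereMeasure = 0 := by simp [hrot]
    have hc : ∀ i j, Continuous fun ω : Metric.sphere (0 : E3) 1 =>
      ((ω : E3) i * (kd i j * V j (ρ • (ω : E3)) + ρ * (ω : E3) i * pd j (V j) (ρ • (ω : E3))) -
      (ω : E3) j * (V j (ρ • (ω : E3)) + ρ * (ω : E3) i * pd i (V j) (ρ • (ω : E3)))) := by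
      intro i j
      have hcoord : ∀ k, Continuous fun ω : Metric.sphere (0 : E3) 1 => (ω : E3) k :=
        fun k => by fun_prop
      exact ((hcoord i).mul (((hVc j).const_mul _).add
        (((hcoord i).const_mul ρ).mul (hpc j j)))).sub ((hcoord j).mul ((hVc j).add
        (((hcoord i).const_mul ρ).mul (hpc i j))))
    simp_rw [← integral_finsetSum _ fun j _ => hint (hc _ j)] at h0
    rw [← integral_finsetSum _ fun i _ => hint (continuous_finsetSum _ fun j _ => hc i j)] at h0
    rw [← h0]
    refine integral_congr_ae (Eventually.of_forall fun ω => ?_)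
    have hω : (ω : E3) 0 ^ 2 + (ω : E3) 1 ^ 2 + (ω : E3) 2 ^ 2 = 1 := by
      have h1 : ‖(ω : E3)‖ ^ 2 = 1 := by simp
      rw [EuclideanSpace.norm_sq_eq] at h1
      simpa [Fin.sum_univ_three] using h1
    simp only [fderiv_apply_eq_sum_pd, Fin.sum_univ_three, kd]
    simp
    linear_combination (-ρ * (pd 0 (V 0) (ρ • (ω : E3)) + pd 1 (V 1) (ρ • (ω : E3)) +
      pd 2 (V 2) (ρ • (ω : E3)))) * hω
  have hD : Integrable (fun ω : Metric.sphere (0 : E3) 1 => ∑ j, pd j (V j) (ρ • (ω : E3)))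
      sphereMeasure := hint (continuous_finsetSum _ fun j _ => hpc j j)
  have hI0 : Integrable (fun ω : Metric.sphere (0 : E3) 1 =>
      ∑ j, V j (ρ • (ω : E3)) * (ω : E3) j) sphereMeasure :=
    hint (continuous_finsetSum _ fun j _ => (hVc j).mul (by fun_prop))
  have hW : Integrable (fun ω : Metric.sphere (0 : E3) 1 =>
      ∑ j, fderiv ℝ (V j) (ρ • (ω : E3)) (ω : E3) * (ω : E3) j) sphereMeasure := by
    simp only [fderiv_apply_eq_sum_pd]
    refine hint (continuous_finsetSum _ fun j _ => Continuous.mul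
      (continuous_finsetSum _ fun k _ => Continuous.mul (by fun_prop) (hpc k j)) (by fun_prop))
  have hDI : Integrable (fun ω : Metric.sphere (0 : E3) 1 => ρ * ∑ j, pd j (V j) (ρ • (ω : E3)) -
      2 * ∑ j, V j (ρ • (ω : E3)) * (ω : E3) j) sphereMeasure :=
    (hD.const_mul ρ).sub (hI0.const_mul 2)
  rw [integral_sub hDI (hW.const_mul ρ), integral_sub (hD.const_mul ρ) (hI0.const_mul 2),
    integral_const_mul, integral_const_mul,
    integral_const_mul] at hsum
  refine HasDerivAt.congr_of_eventuallyEq ?_ hS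
  refine ((hasDerivAt_pow 2 ρ).fun_mul hI).congr_deriv ?_
  simp only [sphereIntegral, I, sphereMeasure] at hsum ⊢
  push_cast
  linear_combination -ρ * hsum

end AsymptoticallyFlat

namespace AsymptoticallyFlat

open Asymptotics Bornology

/-! ### Decay at infinity -/

/-- `f = O(r^{-a})`. -/
def Dec (a : ℝ) (f : E3 → ℝ) : Prop := f =O[cobounded E3] fun x => ‖x‖ ^ (-a)

lemma eventually_lt_norm (R : ℝ) : ∀ᶠ x : E3 in cobounded E3, R < ‖x‖ :=
  tendsto_norm_cobounded_atTop.eventually (eventually_gt_atTop R)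

lemma dec_of_bound {a C R : ℝ} {f : E3 → ℝ} (h : ∀ x : E3, R < ‖x‖ → |f x| ≤ C * ‖x‖ ^ (-a)) :
    Dec a f := by
  refine IsBigO.of_bound C ?_
  filter_upwards [eventually_lt_norm R] with x hx
  rw [Real.norm_eq_abs, Real.norm_eq_abs, abs_of_nonneg (Real.rpow_nonneg (norm_nonneg x) _)]
  exact h x hx

lemma Dec.exists_bound {a : ℝ} {f : E3 → ℝ} (h : Dec a f) :
    ∃ C R : ℝ, 0 < R ∧ 0 ≤ C ∧ ∀ x : E3, R < ‖x‖ → |f x| ≤ C * ‖x‖ ^ (-a) := by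
  obtain ⟨C, hC, hb⟩ := h.exists_nonneg
  have hb' := hb.bound
  rw [hasBasis_cobounded_norm.eventually_iff] at hb'
  obtain ⟨R, -, hR⟩ := hb'
  refine ⟨C, max R 1, by positivity, hC, fun x hx => ?_⟩
  have := hR (x := x) ((le_max_left R 1).trans hx.le)
  rwa [Real.norm_eq_abs, Real.norm_eq_abs,
    abs_of_nonneg (Real.rpow_nonneg (norm_nonneg x) _)] at this

lemma Dec.congr {a : ℝ} {f g : E3 → ℝ} (h : Dec a f) (hfg : f =ᶠ[cobounded E3] g) : Dec a g :=
  h.congr' hfg EventuallyEq.rfl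

lemma Dec.mono {a b : ℝ} {f : E3 → ℝ} (h : Dec a f) (hab : b ≤ a) : Dec b f := by
  refine h.trans (IsBigO.of_bound 1 ?_)
  filter_upwards [eventually_lt_norm 1] with x hx
  have h0 : 0 ≤ ‖x‖ := norm_nonneg x
  rw [Real.norm_eq_abs, Real.norm_eq_abs, abs_of_nonneg (Real.rpow_nonneg h0 _),
    abs_of_nonneg (Real.rpow_nonneg h0 _), one_mul]
  exact Real.rpow_le_rpow_of_exponent_le hx.le (by linarith)

lemma Dec.zero (a : ℝ) : Dec a fun _ => 0 := isBigO_zero _ _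

lemma Dec.add {a : ℝ} {f g : E3 → ℝ} (hf : Dec a f) (hg : Dec a g) :
    Dec a fun x => f x + g x := IsBigO.add hf hg

lemma Dec.sub {a : ℝ} {f g : E3 → ℝ} (hf : Dec a f) (hg : Dec a g) :
    Dec a fun x => f x - g x := IsBigO.sub hf hg

lemma Dec.const_mul {a : ℝ} {f : E3 → ℝ} (hf : Dec a f) (c : ℝ) : Dec a fun x => c * f x :=
  hf.const_mul_left c

lemma Dec.mul {a b : ℝ} {f g : E3 → ℝ} (hf : Dec a f) (hg : Dec b g) :
    Dec (a + b) fun x => f x * g x := by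
  refine (IsBigO.mul hf hg).congr' EventuallyEq.rfl ?_
  filter_upwards [eventually_lt_norm 0] with x hx
  rw [← Real.rpow_add hx, neg_add]

lemma Dec.sum {ι : Type*} {s : Finset ι} {a : ℝ} {f : ι → E3 → ℝ} (h : ∀ i ∈ s, Dec a (f i)) :
    Dec a fun x => ∑ i ∈ s, f i x := IsBigO.fun_sum h

lemma Dec.const (c : ℝ) : Dec 0 fun _ => c := by
  refine dec_of_bound (C := |c|) (R := 0) fun x _ => ?_
  simp

/-- `f = f' + O(r^{-a-q})` with a leading term `f' = O(r^{-a})`. -/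
structure Approx (q a : ℝ) (f f' : E3 → ℝ) : Prop where
  model : Dec a f'
  rem : Dec (a + q) fun x => f x - f' x

namespace Approx

variable {q a b : ℝ} {f f' g g' : E3 → ℝ}

lemma dec (hq : 0 ≤ q) (h : Approx q a f f') : Dec a f :=
  ((h.rem.mono (by linarith)).add h.model).congr (Eventually.of_forall fun x => by simp)

lemma congr (h : Approx q a f f') (hfg : f =ᶠ[cobounded E3] g) : Approx q a g f' :=
  ⟨h.model, h.rem.congr (hfg.mono fun x hx => by simp only [hx])⟩

lemma add (hf : Approx q a f f') (hg : Approx q a g g') :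
    Approx q a (fun x => f x + g x) (fun x => f' x + g' x) :=
  ⟨hf.model.add hg.model,
    (hf.rem.add hg.rem).congr (Eventually.of_forall fun x => by simp only; ring)⟩

lemma sub (hf : Approx q a f f') (hg : Approx q a g g') :
    Approx q a (fun x => f x - g x) (fun x => f' x - g' x) :=
  ⟨hf.model.sub hg.model,
    (hf.rem.sub hg.rem).congr (Eventually.of_forall fun x => by simp only; ring)⟩

lemma const_mul (hf : Approx q a f f') (c : ℝ) :
    Approx q a (fun x => c * f x) (fun x => c * f' x) :=
  ⟨hf.model.const_mul c,
    (hf.rem.const_mul c).congr (Eventually.of_forall fun x => by simp only; ring)⟩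

/-- The error splits as `(f - f') g + f' (g - g')`. -/
lemma mul (hq : 0 ≤ q) (hf : Approx q a f f') (hg : Approx q b g g') :
    Approx q (a + b) (fun x => f x * g x) (fun x => f' x * g' x) :=
  ⟨hf.model.mul hg.model,
    (((hf.rem.mul (hg.dec hq)).mono (b := a + b + q) (by linarith)).add
      ((hf.model.mul hg.rem).mono (b := a + b + q) (by linarith))).congr
      (Eventually.of_forall fun x => by simp only; ring)⟩

lemma sum {ι : Type*} {s : Finset ι} {f f' : ι → E3 → ℝ}
    (h : ∀ i ∈ s, Approx q a (f i) (f' i)) :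
    Approx q a (fun x => ∑ i ∈ s, f i x) (fun x => ∑ i ∈ s, f' i x) :=
  ⟨Dec.sum fun i hi => (h i hi).model, (Dec.sum fun i hi => (h i hi).rem).congr
    (Eventually.of_forall fun x => by simp)⟩

lemma of_dec (h : Dec (a + q) f) : Approx q a f fun _ => 0 :=
  ⟨Dec.zero a, by simpa using h⟩

lemma cast (h : Approx q a f f') (hab : a = b) : Approx q b f f' := hab ▸ h

end Approx

/-! ### Partial derivatives -/

lemma pd_congr {f g : E3 → ℝ} {x : E3} (h : f =ᶠ[𝓝 x] g) (k : Fin 3) : pd k f x = pd k g x := by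
  simp only [pd, h.fderiv_eq]

lemma pd_add {f g : E3 → ℝ} {x : E3} (hf : DifferentiableAt ℝ f x) (hg : DifferentiableAt ℝ g x)
    (k : Fin 3) : pd k (fun y => f y + g y) x = pd k f x + pd k g x := by
  simp [pd, fderiv_fun_add hf hg]

lemma pd_sub {f g : E3 → ℝ} {x : E3} (hf : DifferentiableAt ℝ f x) (hg : DifferentiableAt ℝ g x)
    (k : Fin 3) : pd k (fun y => f y - g y) x = pd k f x - pd k g x := by
  simp [pd, fderiv_fun_sub hf hg]

lemma pd_mul {f g : E3 → ℝ} {x : E3} (hf : DifferentiableAt ℝ f x) (hg : DifferentiableAt ℝ g x)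
    (k : Fin 3) : pd k (fun y => f y * g y) x = f x * pd k g x + g x * pd k f x := by
  simp [pd, fderiv_fun_mul hf hg]

lemma pd_const_mul {f : E3 → ℝ} {x : E3} (hf : DifferentiableAt ℝ f x) (c : ℝ)
    (k : Fin 3) : pd k (fun y => c * f y) x = c * pd k f x := by
  simp [pd, fderiv_const_mul hf]

lemma pd_mul_const {f : E3 → ℝ} {x : E3} (hf : DifferentiableAt ℝ f x) (c : ℝ)
    (k : Fin 3) : pd k (fun y => f y * c) x = pd k f x * c := by
  simp only [mul_comm _ c, pd_const_mul hf]

lemma pd_const (c : ℝ) (x : E3) (k : Fin 3) : pd k (fun _ => c) x = 0 := by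
  simp [pd]

lemma pd_sum {ι : Type*} {s : Finset ι} {f : ι → E3 → ℝ} {x : E3}
    (hf : ∀ i ∈ s, DifferentiableAt ℝ (f i) x) (k : Fin 3) :
    pd k (fun y => ∑ i ∈ s, f i y) x = ∑ i ∈ s, pd k (f i) x := by
  simp [pd, fderiv_fun_sum hf, sum_apply]

lemma pd_pow {f : E3 → ℝ} {x : E3} (hf : DifferentiableAt ℝ f x) (n : ℕ) (k : Fin 3) :
    pd k (fun y => f y ^ n) x = n * f x ^ (n - 1) * pd k f x := by
  simp only [pd, (hf.hasFDerivAt.pow n).fderiv]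
  simp

lemma pd_coord (i k : Fin 3) (x : E3) : pd k (fun y : E3 => y i) x = kd i k := by
  have h : HasFDerivAt (fun x : E3 => x i) (EuclideanSpace.proj i : E3 →L[ℝ] ℝ) x :=
    (EuclideanSpace.proj i : E3 →L[ℝ] ℝ).hasFDerivAt
  simp [pd, h.fderiv, kd]

lemma contDiffOn_pd {f : E3 → ℝ} {U : Set E3} (hU : IsOpen U) (hf : ContDiffOn ℝ 2 f U)
    (k : Fin 3) : ContDiffOn ℝ 1 (pd k f) U :=
  (hf.fderiv_of_isOpen hU (by norm_num)).clm_apply contDiffOn_const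

/-! ### Homogeneous functions -/

/-- `f` is homogeneous of degree `-n`. -/
def Homog (n : ℕ) (f : E3 → ℝ) : Prop := ∀ c : ℝ, 0 < c → ∀ x, f (c • x) = (c ^ n)⁻¹ * f x

lemma pd_comp_smul (f : E3 → ℝ) (c : ℝ) (x : E3) (k : Fin 3) :
    pd k (fun y => f (c • y)) x = c * pd k f (c • x) := by
  simp [pd, fderiv_comp_smul]

/-- No differentiability is needed: `fderiv` respects dilations and scalar multiples even where it
takes its default value `0`. The parity lemmas `pd_even` and `pd_odd` rest on the same fact with the
factor `-1`. -/
lemma Homog.pd {n : ℕ} {f : E3 → ℝ} (hf : Homog n f) (k : Fin 3) : Homog (n + 1) (pd k f) := by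
  intro c hc x
  have h1 := pd_comp_smul f c x k
  have h2 : AsymptoticallyFlat.pd k (fun y => f (c • y)) x =
      (c ^ n)⁻¹ * AsymptoticallyFlat.pd k f x := by
    rw [funext (hf c hc)]
    change fderiv ℝ ((c ^ n)⁻¹ • f) x _ = _
    rw [fderiv_const_smul_field]
    rfl
  rw [h2] at h1
  field_simp at h1 ⊢
  linear_combination -h1

lemma pd_comp_neg (f : E3 → ℝ) (x : E3) (k : Fin 3) :
    pd k (fun y => f (-y)) x = -pd k f (-x) := by
  simpa using pd_comp_smul f (-1) x k

lemma pd_neg (f : E3 → ℝ) (x : E3) (k : Fin 3) : pd k (fun y => -f y) x = -pd k f x := by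
  simp [pd, fderiv_fun_neg]

lemma pd_even {f : E3 → ℝ} (hf : ∀ x, f (-x) = f x) (k : Fin 3) (x : E3) :
    pd k f (-x) = -pd k f x := by
  have h := pd_comp_neg f x k
  simp only [hf] at h
  linarith

lemma pd_odd {f : E3 → ℝ} (hf : ∀ x, f (-x) = -f x) (k : Fin 3) (x : E3) :
    pd k f (-x) = pd k f x := by
  have h := pd_comp_neg f x k
  simp only [hf, pd_neg] at h
  linarith

/-- Continuity bounds `f` on the compact unit sphere, and homogeneity carries this bound to every
radius. -/
lemma Homog.dec {n : ℕ} {f : E3 → ℝ} (hf : Homog n f) (hc : ContinuousOn f {0}ᶜ) : Dec n f := by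
  obtain ⟨C, hC⟩ := (isCompact_sphere (0 : E3) 1).exists_bound_of_continuousOn
    (hc.mono fun x hx h0 => by simp [Set.mem_singleton_iff.1 h0] at hx)
  refine dec_of_bound (C := C) (R := 0) fun x hx => ?_
  have h1 : f x = (‖x‖ ^ n)⁻¹ * f (‖x‖⁻¹ • x) := by
    rw [← hf _ hx, smul_inv_smul₀ hx.ne']
  have h2 := hC (‖x‖⁻¹ • x) (by simp [norm_smul, hx.ne'])
  rw [h1, abs_mul, Real.rpow_neg hx.le, Real.rpow_natCast, abs_of_pos (by positivity), mul_comm]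
  gcongr
  exact h2

end AsymptoticallyFlat

namespace AsymptoticallyFlat

open Asymptotics Bornology

/-! ### The algebra of the scalar curvature -/

/-- The Christoffel symbols of the first kind (doubled) as a linear function of the first
derivatives `P k i j = ∂ₖ gᵢⱼ` of the metric. -/
def chr (P : Fin 3 → Fin 3 → Fin 3 → ℝ) (l i j : Fin 3) : ℝ := P i j l + P j i l - P l i j

/-- The linearised Ricci tensor of the second derivatives `H m k i j = ∂ₘ ∂ₖ gᵢⱼ`. -/
def linRicci (H : Fin 3 → Fin 3 → Fin 3 → Fin 3 → ℝ) (i k : Fin 3) : ℝ :=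
  ∑ j, ((1 / 2) * chr (H j) j i k - (1 / 2) * chr (H i) j j k)

/-- The linearised scalar curvature `∑ᵢⱼ (∂ⱼ ∂ᵢ gᵢⱼ - ∂ⱼ ∂ⱼ gᵢᵢ)`. -/
def linScalar (H : Fin 3 → Fin 3 → Fin 3 → Fin 3 → ℝ) : ℝ :=
  ∑ j, ∑ i, (H j i i j - H j j i i)

/-- The nonlinear part of the scalar curvature as a function of `k = δ - g⁻¹`, of the derivatives
`D m i j = ∂ₘ gⁱʲ`, the Christoffel symbols of the first kind `c` with derivatives `dc`,
the Christoffel symbols `Γ` and the Ricci curvature `Ric`. -/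
def quad (k : Fin 3 → Fin 3 → ℝ) (D c : Fin 3 → Fin 3 → Fin 3 → ℝ)
    (dc : Fin 3 → Fin 3 → Fin 3 → Fin 3 → ℝ) (Γ : Fin 3 → Fin 3 → Fin 3 → ℝ)
    (Ric : Fin 3 → Fin 3 → ℝ) : ℝ :=
  ∑ i, ∑ j, ∑ l, ((1 / 2) * (D j j l * c l i i - k j l * dc j l i i) -
    (1 / 2) * (D i j l * c l j i - k j l * dc i l j i)) +
  ∑ i, ∑ j, ∑ m, (Γ m i i * Γ j j m - Γ m j i * Γ j i m) - ∑ i, ∑ j, k i j * Ric i j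

/-- The quadratic part of the scalar curvature of `δ + h`. -/
def quadModel (h : Fin 3 → Fin 3 → ℝ) (P : Fin 3 → Fin 3 → Fin 3 → ℝ)
    (H : Fin 3 → Fin 3 → Fin 3 → Fin 3 → ℝ) : ℝ :=
  quad h (fun m i j => -P m i j) (chr P) (fun m => chr (H m))
    (fun k i j => (1 / 2) * chr P k i j) (linRicci H)

lemma sum_kd_mul (f : Fin 3 → ℝ) (i : Fin 3) : ∑ j, kd i j * f j = f i := by
  simp [kd]

/-- Only the symmetry of `H` in its two metric indices enters; the partial derivatives never have to
be interchanged. -/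
lemma sum_sum_linearised (H : Fin 3 → Fin 3 → Fin 3 → Fin 3 → ℝ)
    (hH : ∀ m k i j, H m k i j = H m k j i) :
    ∑ i, ∑ j, ((1 / 2) * chr (H j) j i i - (1 / 2) * chr (H i) j j i) = linScalar H := by
  have h1 : ∀ i j, (1 / 2) * chr (H j) j i i - (1 / 2) * chr (H i) j j i =
      (H j i i j - (1 / 2) * H j j i i) - (1 / 2) * H i i j j := by
    intro i j
    simp only [chr]
    rw [hH i j j i]
    ring
  have h2 : ∑ i, ∑ j, H i i j j = ∑ i, ∑ j, H j j i i := Finset.sum_comm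
  have h3 : ∑ i, ∑ j, H j i i j = ∑ j, ∑ i, H j i i j := Finset.sum_comm
  simp only [h1, Finset.sum_sub_distrib, ← Finset.mul_sum, linScalar]
  linear_combination h3 + (1 / 2) * h2

variable {g : E3 → Matrix (Fin 3) (Fin 3) ℝ} {R₀ : ℝ} {x : E3}

lemma IsRiemannianMetricOn.contDiffAt (hg : IsRiemannianMetricOn g (exterior R₀))
    (hx : x ∈ exterior R₀) (i j : Fin 3) : ContDiffAt ℝ 2 (fun y => g y i j) x :=
  (hg.contDiffOn i j).contDiffAt ((isOpen_exterior R₀).mem_nhds hx)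

lemma IsRiemannianMetricOn.differentiableAt (hg : IsRiemannianMetricOn g (exterior R₀))
    (hx : x ∈ exterior R₀) (i j : Fin 3) : DifferentiableAt ℝ (fun y => g y i j) x :=
  (hg.contDiffAt hx i j).differentiableAt two_ne_zero

lemma IsRiemannianMetricOn.contDiffOn_pd (hg : IsRiemannianMetricOn g (exterior R₀))
    (i j k : Fin 3) : ContDiffOn ℝ 1 (pd k fun y => g y i j) (exterior R₀) :=
  AsymptoticallyFlat.contDiffOn_pd (isOpen_exterior R₀) (hg.contDiffOn i j) k

lemma IsRiemannianMetricOn.differentiableAt_pd (hg : IsRiemannianMetricOn g (exterior R₀))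
    (hx : x ∈ exterior R₀) (i j k : Fin 3) : DifferentiableAt ℝ (pd k fun y => g y i j) x :=
  ((hg.contDiffOn_pd i j k).contDiffAt ((isOpen_exterior R₀).mem_nhds hx)).differentiableAt
    one_ne_zero

lemma IsRiemannianMetricOn.symm (hg : IsRiemannianMetricOn g (exterior R₀))
    (hx : x ∈ exterior R₀) (i j : Fin 3) : g x i j = g x j i := by
  simpa using ((hg.posDef x hx).isHermitian.apply j i)

lemma IsRiemannianMetricOn.isUnit_det (hg : IsRiemannianMetricOn g (exterior R₀))
    (hx : x ∈ exterior R₀) : IsUnit (g x).det := (hg.posDef x hx).det_pos.ne'.isUnit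

/-- By Cramer's rule the entries of the inverse are polynomials in the metric divided by the
positive determinant. -/
lemma IsRiemannianMetricOn.differentiableAt_inv (hg : IsRiemannianMetricOn g (exterior R₀))
    (hx : x ∈ exterior R₀) (i j : Fin 3) : DifferentiableAt ℝ (fun y => (g y)⁻¹ i j) x := by
  have h := hg.differentiableAt hx
  have hdet : DifferentiableAt ℝ (fun y => (g y).det) x := by
    simp only [Matrix.det_fin_three]
    fun_prop
  have hadj : DifferentiableAt ℝ (fun y => (g y).adjugate i j) x := by
    simp only [Matrix.adjugate_fin_three]
    fin_cases i <;> fin_cases j <;> simp <;> fun_prop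
  simp only [Matrix.inv_def, Ring.inverse_eq_inv', Matrix.smul_apply, smul_eq_mul]
  exact (hdet.inv (hg.posDef x hx).det_pos.ne').mul hadj

/-- The first derivatives of the metric. -/
def dg (g : E3 → Matrix (Fin 3) (Fin 3) ℝ) (x : E3) (k i j : Fin 3) : ℝ :=
  pd k (fun y => g y i j) x

/-- The second derivatives of the metric. -/
def ddg (g : E3 → Matrix (Fin 3) (Fin 3) ℝ) (x : E3) (m k i j : Fin 3) : ℝ :=
  pd m (pd k fun y => g y i j) x

/-- The first derivatives of the inverse metric. -/
def dinv (g : E3 → Matrix (Fin 3) (Fin 3) ℝ) (x : E3) (m i j : Fin 3) : ℝ :=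
  pd m (fun y => (g y)⁻¹ i j) x

lemma differentiableAt_chr (hg : IsRiemannianMetricOn g (exterior R₀)) (hx : x ∈ exterior R₀)
    (l i j : Fin 3) : DifferentiableAt ℝ (fun y => chr (dg g y) l i j) x :=
  ((hg.differentiableAt_pd hx j l i).add (hg.differentiableAt_pd hx i l j)).sub
    (hg.differentiableAt_pd hx i j l)

lemma pd_chr (hg : IsRiemannianMetricOn g (exterior R₀)) (hx : x ∈ exterior R₀)
    (l i j m : Fin 3) : pd m (fun y => chr (dg g y) l i j) x = chr (ddg g x m) l i j := by
  have h1 := hg.differentiableAt_pd hx j l i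
  have h2 := hg.differentiableAt_pd hx i l j
  have h3 := hg.differentiableAt_pd hx i j l
  simp only [chr, dg, ddg]
  rw [pd_sub (h1.fun_add h2) h3, pd_add h1 h2]

lemma pd_christoffel (hg : IsRiemannianMetricOn g (exterior R₀)) (hx : x ∈ exterior R₀)
    (k i j m : Fin 3) : pd m (christoffel g k i j) x =
      (1 / 2) * ∑ l, (dinv g x m k l * chr (dg g x) l i j +
        (g x)⁻¹ k l * chr (ddg g x m) l i j) := by
  have hd : ∀ l ∈ Finset.univ, DifferentiableAt ℝ
      (fun y => (g y)⁻¹ k l * chr (dg g y) l i j) x := fun l _ =>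
    (hg.differentiableAt_inv hx k l).mul (differentiableAt_chr hg hx l i j)
  rw [show christoffel g k i j = fun y => (1 / 2) * ∑ l, (g y)⁻¹ k l * chr (dg g y) l i j from rfl,
    pd_const_mul (DifferentiableAt.fun_sum hd), pd_sum hd]
  congr 1
  refine Finset.sum_congr rfl fun l _ => ?_
  rw [pd_mul (hg.differentiableAt_inv hx k l) (differentiableAt_chr hg hx l i j),
    pd_chr hg hx, dinv]
  ring

lemma pd_symm (hg : IsRiemannianMetricOn g (exterior R₀)) (hx : x ∈ exterior R₀)
    (k i j : Fin 3) : pd k (fun y => g y i j) x = pd k (fun y => g y j i) x :=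
  pd_congr ((isOpen_exterior R₀).eventually_mem hx |>.mono fun _ hy => hg.symm hy i j) k

lemma ddg_symm (hg : IsRiemannianMetricOn g (exterior R₀)) (hx : x ∈ exterior R₀)
    (m k i j : Fin 3) : ddg g x m k i j = ddg g x m k j i :=
  pd_congr ((isOpen_exterior R₀).eventually_mem hx |>.mono fun _ hy => pd_symm hg hy k i j) m

/-- The scalar curvature is the sum of its linear and its nonlinear part. -/
lemma scalarCurvature_eq (hg : IsRiemannianMetricOn g (exterior R₀)) (hx : x ∈ exterior R₀) :
    scalarCurvature g x = linScalar (ddg g x) +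
      quad (fun i j => kd i j - (g x)⁻¹ i j) (dinv g x) (chr (dg g x)) (fun m => chr (ddg g x m))
        (fun k i j => christoffel g k i j x) (fun i j => ricci g i j x) := by
  have hR : scalarCurvature g x = ∑ i, ricci g i i x -
      ∑ i, ∑ j, (kd i j - (g x)⁻¹ i j) * ricci g i j x := by
    simp only [scalarCurvature, sub_mul, Finset.sum_sub_distrib, sum_kd_mul]
    ring
  -- Writing `g⁻¹ = δ - k` separates the linear term of `∂Γ` from the products containing `∂g⁻¹` or
  -- `k`.
  have hT : ∀ m j l i, pd m (christoffel g j l i) x = (1 / 2) * chr (ddg g x m) j l i +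
      ∑ a, (1 / 2) * (dinv g x m j a * chr (dg g x) a l i -
        (kd j a - (g x)⁻¹ j a) * chr (ddg g x m) a l i) := by
    intro m j l i
    rw [pd_christoffel hg hx]
    simp only [sub_mul, mul_sub, mul_add, Finset.sum_sub_distrib, Finset.sum_add_distrib,
      ← Finset.mul_sum, sum_kd_mul]
    ring
  have hRic : ∀ i, ricci g i i x =
      ∑ j, ((1 / 2) * chr (ddg g x j) j i i - (1 / 2) * chr (ddg g x i) j j i) +
      ∑ j, ∑ l, ((1 / 2) * (dinv g x j j l * chr (dg g x) l i i -
        (kd j l - (g x)⁻¹ j l) * chr (ddg g x j) l i i) -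
        (1 / 2) * (dinv g x i j l * chr (dg g x) l j i -
        (kd j l - (g x)⁻¹ j l) * chr (ddg g x i) l j i)) +
      ∑ j, ∑ m, (christoffel g m i i x * christoffel g j j m x -
        christoffel g m j i x * christoffel g j i m x) := by
    intro i
    simp only [ricci, hT, Finset.sum_sub_distrib, Finset.sum_add_distrib]
    ring
  rw [hR]
  simp only [hRic]
  rw [Finset.sum_add_distrib, Finset.sum_add_distrib, sum_sum_linearised _ (ddg_symm hg hx), quad]
  ring

end AsymptoticallyFlat

namespace AsymptoticallyFlat

open Asymptotics Bornology

/-! ### The asymptotics of the scalar curvature -/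

lemma Approx.neg {q a : ℝ} {f f' : E3 → ℝ} (h : Approx q a f f') :
    Approx q a (fun x => -f x) (fun x => -f' x) := by
  simpa using h.const_mul (-1)

lemma Approx.chr {q a : ℝ} {P P' : E3 → Fin 3 → Fin 3 → Fin 3 → ℝ}
    (h : ∀ k i j, Approx q a (fun x => P x k i j) (fun x => P' x k i j)) (l i j : Fin 3) :
    Approx q a (fun x => chr (P x) l i j) (fun x => chr (P' x) l i j) :=
  ((h i j l).add (h j i l)).sub (h l i j)

/-- Every term of `quad` is a product of decay orders `2 + 2` or `1 + 3`, so replacing each factor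
by its leading term costs only `O(r^{-4-q})`. -/
lemma Approx.quad {q : ℝ} (hq : 0 ≤ q) {k k' Ric Ric' : E3 → Fin 3 → Fin 3 → ℝ}
    {D D' c c' Γ Γ' : E3 → Fin 3 → Fin 3 → Fin 3 → ℝ}
    {dc dc' : E3 → Fin 3 → Fin 3 → Fin 3 → Fin 3 → ℝ}
    (hk : ∀ i j, Approx q 1 (fun x => k x i j) (fun x => k' x i j))
    (hD : ∀ m i j, Approx q 2 (fun x => D x m i j) (fun x => D' x m i j))
    (hc : ∀ m i j, Approx q 2 (fun x => c x m i j) (fun x => c' x m i j))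
    (hdc : ∀ l m i j, Approx q 3 (fun x => dc x l m i j) (fun x => dc' x l m i j))
    (hΓ : ∀ m i j, Approx q 2 (fun x => Γ x m i j) (fun x => Γ' x m i j))
    (hRic : ∀ i j, Approx q 3 (fun x => Ric x i j) (fun x => Ric' x i j)) :
    Approx q 4 (fun x => quad (k x) (D x) (c x) (dc x) (Γ x) (Ric x))
      (fun x => quad (k' x) (D' x) (c' x) (dc' x) (Γ' x) (Ric' x)) := by
  have e22 : (2 : ℝ) + 2 = 4 := by norm_num
  have e13 : (1 : ℝ) + 3 = 4 := by norm_num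
  refine Approx.sub (Approx.add
    (Approx.sum fun i _ => Approx.sum fun j _ => Approx.sum fun l _ => ?_)
    (Approx.sum fun i _ => Approx.sum fun j _ => Approx.sum fun m _ => ?_))
    (Approx.sum fun i _ => Approx.sum fun j _ => ?_)
  · exact ((((hD _ _ _).mul hq (hc _ _ _)).cast e22).sub
      (((hk _ _).mul hq (hdc _ _ _ _)).cast e13)).const_mul _ |>.sub
      (((((hD _ _ _).mul hq (hc _ _ _)).cast e22).sub
      (((hk _ _).mul hq (hdc _ _ _ _)).cast e13)).const_mul _)
  · exact (((hΓ _ _ _).mul hq (hΓ _ _ _)).cast e22).sub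
      (((hΓ _ _ _).mul hq (hΓ _ _ _)).cast e22)
  · exact ((hk _ _).mul hq (hRic _ _)).cast e13

/-- The metric `g = δ + h + …` has the leading terms `h`, `P`, `H` in its components and in their
derivatives of order one and two. -/
structure MetricApprox (q : ℝ) (g : E3 → Matrix (Fin 3) (Fin 3) ℝ) (h : E3 → Fin 3 → Fin 3 → ℝ)
    (P : E3 → Fin 3 → Fin 3 → Fin 3 → ℝ) (H : E3 → Fin 3 → Fin 3 → Fin 3 → Fin 3 → ℝ) : Prop where
  zero : ∀ i j, Approx q 1 (fun x => g x i j - kd i j) (fun x => h x i j)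
  one : ∀ k i j, Approx q 2 (fun x => dg g x k i j) (fun x => P x k i j)
  two : ∀ m k i j, Approx q 3 (fun x => ddg g x m k i j) (fun x => H x m k i j)

lemma tendsto_zero_of_dec {a : ℝ} (ha : 0 < a) {f : E3 → ℝ} (h : Dec a f) :
    Tendsto f (cobounded E3) (𝓝 0) :=
  h.trans_tendsto ((tendsto_rpow_neg_atTop ha).comp tendsto_norm_cobounded_atTop)

/-- The derivative of the inverse metric is `-g⁻¹ (∂g) g⁻¹`. -/
lemma dinv_eq {g : E3 → Matrix (Fin 3) (Fin 3) ℝ} {R₀ : ℝ}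
    (hg : IsRiemannianMetricOn g (exterior R₀)) {x : E3}
    (hx : x ∈ exterior R₀) (m i j : Fin 3) :
    dinv g x m i j = -∑ b, (∑ a, (g x)⁻¹ i a * dg g x m a b) * (g x)⁻¹ b j := by
  -- This is the derivative of `g⁻¹ g = δ`; multiplying it by `g⁻¹` on the right isolates `∂g⁻¹`.
  have h1 : ∀ b, ∑ a, (dinv g x m i a * g x a b + (g x)⁻¹ i a * dg g x m a b) = 0 := by
    intro b
    have hd : ∀ a ∈ Finset.univ, DifferentiableAt ℝ (fun y => (g y)⁻¹ i a * g y a b) x :=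
      fun a _ => (hg.differentiableAt_inv hx i a).mul (hg.differentiableAt hx a b)
    have h2 : pd m (fun y => ∑ a, (g y)⁻¹ i a * g y a b) x = 0 := by
      rw [← pd_const (kd i b) x m]
      refine pd_congr ?_ m
      filter_upwards [(isOpen_exterior R₀).mem_nhds hx] with y hy
      have := congrFun (congrFun (Matrix.nonsing_inv_mul _ (hg.isUnit_det hy)) i) b
      rw [Matrix.mul_apply] at this
      rw [this]
      simp [kd, Matrix.one_apply]
    rw [pd_sum hd] at h2
    rw [← h2]
    refine Finset.sum_congr rfl fun a _ => ?_
    rw [pd_mul (hg.differentiableAt_inv hx i a) (hg.differentiableAt hx a b), dinv, dg]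
    ring
  have h3 : ∀ a, ∑ b, g x a b * (g x)⁻¹ b j = kd a j := by
    intro a
    have := congrFun (congrFun (Matrix.mul_nonsing_inv _ (hg.isUnit_det hx)) a) j
    rw [Matrix.mul_apply] at this
    rw [this]
    simp [kd, Matrix.one_apply]
  have h4 : ∑ b, (∑ a, dinv g x m i a * g x a b) * (g x)⁻¹ b j = dinv g x m i j := by
    simp only [Finset.sum_mul]
    rw [Finset.sum_comm]
    simp only [mul_assoc, ← Finset.mul_sum, h3]
    simp [kd]
  rw [← h4, ← Finset.sum_neg_distrib]
  refine Finset.sum_congr rfl fun b _ => ?_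
  have := h1 b
  rw [Finset.sum_add_distrib] at this
  linear_combination (g x)⁻¹ b j * this

namespace MetricApprox

variable {q : ℝ} {g : E3 → Matrix (Fin 3) (Fin 3) ℝ} {h : E3 → Fin 3 → Fin 3 → ℝ}
  {P : E3 → Fin 3 → Fin 3 → Fin 3 → ℝ} {H : E3 → Fin 3 → Fin 3 → Fin 3 → Fin 3 → ℝ} {R₀ : ℝ}

lemma tendsto (hA : MetricApprox q g h P H) (hq : 0 ≤ q) : Tendsto g (cobounded E3) (𝓝 1) := by
  refine tendsto_pi_nhds.2 fun i => tendsto_pi_nhds.2 fun j => ?_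
  have := (tendsto_zero_of_dec one_pos ((hA.zero i j).dec hq)).add_const (kd i j)
  simpa [kd, Matrix.one_apply] using this

/-- Inversion is continuous at the identity, to which `g` converges, so `g⁻¹` is bounded near
infinity. -/
lemma dec_inv (hA : MetricApprox q g h P H) (hq : 0 ≤ q) (i j : Fin 3) :
    Dec 0 fun x => (g x)⁻¹ i j := by
  have hcont : ContinuousAt (fun A : Matrix (Fin 3) (Fin 3) ℝ => A⁻¹ i j) 1 := by
    simp only [Matrix.inv_def, Ring.inverse_eq_inv', Matrix.smul_apply, smul_eq_mul]
    refine ContinuousAt.mul (ContinuousAt.inv₀ (by fun_prop) (by simp)) ?_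
    exact (continuous_id.matrix_adjugate.matrix_elem i j).continuousAt
  have := (hcont.tendsto.comp (hA.tendsto hq)).isBigO_one ℝ
  simpa [Dec] using this

/-- `δ - g⁻¹ = h + …`. -/
lemma inv (hA : MetricApprox q g h P H) (hq : 0 ≤ q) (hq1 : q ≤ 1)
    (hg : IsRiemannianMetricOn g (exterior R₀)) (i j : Fin 3) :
    Approx q 1 (fun x => kd i j - (g x)⁻¹ i j) (fun x => h x i j) := by
  have hinv : ∀ i j, (fun x => ∑ l, (g x)⁻¹ i l * (g x l j - kd l j)) =ᶠ[cobounded E3]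
      fun x => kd i j - (g x)⁻¹ i j := by
    intro i j
    filter_upwards [eventually_lt_norm R₀] with x hx
    have h1 : ((g x)⁻¹ * g x) i j = kd i j := by
      rw [Matrix.nonsing_inv_mul _ (hg.isUnit_det hx)]
      simp [kd, Matrix.one_apply]
    rw [Matrix.mul_apply] at h1
    simp only [mul_sub, Finset.sum_sub_distrib, h1]
    simp [kd]
  -- From `k = δ - g⁻¹ = g⁻¹ (g - δ)` comes `k = O(r⁻¹)`. Then `k = (g - δ) - k (g - δ)`, whose last
  -- product is `O(r⁻²)` and is absorbed in `O(r^{-1-q})` because `q ≤ 1`.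
  have hk : ∀ i j, Dec 1 fun x => kd i j - (g x)⁻¹ i j := fun i j =>
    (Dec.sum fun l _ => ((hA.dec_inv hq i l).mul ((hA.zero l j).dec hq)).mono
      (by linarith)).congr (hinv i j)
  refine ⟨(hA.zero i j).model, ?_⟩
  have h2 : Dec (1 + q) fun x => ∑ l, (kd i l - (g x)⁻¹ i l) * (g x l j - kd l j) :=
    Dec.sum fun l _ => ((hk i l).mul ((hA.zero l j).dec hq)).mono (by linarith)
  refine ((hA.zero i j).rem.sub h2).congr ?_
  filter_upwards [hinv i j] with x hx
  rw [← hx]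
  simp only [sub_mul, Finset.sum_sub_distrib, sum_kd_mul]
  ring

lemma inv_zero (hA : MetricApprox q g h P H) (hq : 0 ≤ q) (hq1 : q ≤ 1)
    (hg : IsRiemannianMetricOn g (exterior R₀)) (i j : Fin 3) :
    Approx q 0 (fun x => (g x)⁻¹ i j) (fun _ => kd i j) := by
  refine ⟨Dec.const _, ?_⟩
  refine ((((hA.inv hq hq1 hg i j).dec hq).const_mul (-1)).mono (b := 0 + q)
    (by linarith)).congr (Eventually.of_forall fun x => ?_)
  simp

lemma dinv (hA : MetricApprox q g h P H) (hq : 0 ≤ q) (hq1 : q ≤ 1)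
    (hg : IsRiemannianMetricOn g (exterior R₀)) (m i j : Fin 3) :
    Approx q 2 (fun x => dinv g x m i j) (fun x => -P x m i j) := by
  have h1 : Approx q 2 (fun x => -∑ b, (∑ a, (g x)⁻¹ i a * dg g x m a b) * (g x)⁻¹ b j)
      (fun x => -∑ b, (∑ a, kd i a * P x m a b) * kd b j) :=
    (Approx.sum fun b _ => ((Approx.sum fun a _ => (hA.inv_zero hq hq1 hg i a).mul hq
      (hA.one m a b)).mul hq (hA.inv_zero hq hq1 hg b j)).cast (by norm_num)).neg
  simp only [sum_kd_mul] at h1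
  have h2 : ∀ x, ∑ b, P x m i b * kd b j = P x m i j := fun x => by simp [kd]
  simp only [h2] at h1
  refine h1.congr ?_
  filter_upwards [eventually_lt_norm R₀] with x hx
  rw [dinv_eq hg hx]

lemma christoffel (hA : MetricApprox q g h P H) (hq : 0 ≤ q) (hq1 : q ≤ 1)
    (hg : IsRiemannianMetricOn g (exterior R₀)) (k i j : Fin 3) :
    Approx q 2 (fun x => christoffel g k i j x) (fun x => (1 / 2) * chr (P x) k i j) := by
  have h1 : Approx q 2 (fun x => (1 / 2) * ∑ l, (g x)⁻¹ k l * chr (dg g x) l i j)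
      (fun x => (1 / 2) * ∑ l, kd k l * chr (P x) l i j) :=
    (Approx.sum fun l _ => ((hA.inv_zero hq hq1 hg k l).mul hq
      (Approx.chr hA.one l i j)).cast (by norm_num)).const_mul _
  simp only [sum_kd_mul] at h1
  exact h1

lemma pd_christoffel (hA : MetricApprox q g h P H) (hq : 0 ≤ q) (hq1 : q ≤ 1)
    (hg : IsRiemannianMetricOn g (exterior R₀)) (k i j m : Fin 3) :
    Approx q 3 (fun x => pd m (AsymptoticallyFlat.christoffel g k i j) x)
      (fun x => (1 / 2) * chr (H x m) k i j) := by
  have h1 : Approx q 3 (fun x => (1 / 2) * ∑ l, (AsymptoticallyFlat.dinv g x m k l *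
        chr (dg g x) l i j + (g x)⁻¹ k l * chr (ddg g x m) l i j))
      (fun x => (1 / 2) * ∑ l, (0 + kd k l * chr (H x m) l i j)) := by
    refine (Approx.sum fun l _ => Approx.add (Approx.of_dec ?_)
      (((hA.inv_zero hq hq1 hg k l).mul hq
      (Approx.chr (hA.two m) l i j)).cast (by norm_num))).const_mul _
    -- The product `∂g⁻¹ ∂g` is `O(r⁻⁴)`, which `q ≤ 1` puts into the error `O(r^{-3-q})`. The
    -- products `Γ Γ` in the Ricci curvature are discarded for the same reason.
    exact (((hA.dinv hq hq1 hg m k l).dec hq).mul ((Approx.chr hA.one l i j).dec hq)).mono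
      (by linarith)
  simp only [zero_add, sum_kd_mul] at h1
  refine h1.congr ?_
  filter_upwards [eventually_lt_norm R₀] with x hx
  rw [AsymptoticallyFlat.pd_christoffel hg hx]

lemma ricci (hA : MetricApprox q g h P H) (hq : 0 ≤ q) (hq1 : q ≤ 1)
    (hg : IsRiemannianMetricOn g (exterior R₀)) (i k : Fin 3) :
    Approx q 3 (fun x => ricci g i k x) (fun x => linRicci (H x) i k) := by
  have hΓ := fun k i j => (hA.christoffel hq hq1 hg k i j).dec hq
  have h1 := (Approx.sum (s := Finset.univ) fun j _ => (hA.pd_christoffel hq hq1 hg j i k j).sub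
    (hA.pd_christoffel hq hq1 hg j j k i)).add (Approx.of_dec (q := q) (a := 3)
    (f := fun x => ∑ j, ∑ m, (AsymptoticallyFlat.christoffel g m i k x *
      AsymptoticallyFlat.christoffel g j j m x - AsymptoticallyFlat.christoffel g m j k x *
      AsymptoticallyFlat.christoffel g j i m x)) (Dec.sum fun j _ => Dec.sum fun m _ =>
      (((hΓ _ _ _).mul (hΓ _ _ _)).sub ((hΓ _ _ _).mul (hΓ _ _ _))).mono (by linarith)))
  simp only [add_zero] at h1
  exact h1

/-- The quadratic expansion of the scalar curvature of an asymptotically flat metric. -/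
lemma scalarCurvature (hA : MetricApprox q g h P H) (hq : 0 ≤ q) (hq1 : q ≤ 1)
    (hg : IsRiemannianMetricOn g (exterior R₀)) :
    Dec (4 + q) fun x => scalarCurvature g x -
      (linScalar (ddg g x) + quadModel (h x) (P x) (H x)) := by
  have h1 := (Approx.quad hq (hA.inv hq hq1 hg) (hA.dinv hq hq1 hg) (Approx.chr hA.one)
    (fun m => Approx.chr (hA.two m)) (hA.christoffel hq hq1 hg) (hA.ricci hq hq1 hg)).rem
  refine h1.congr ?_
  filter_upwards [eventually_lt_norm R₀] with x hx
  rw [scalarCurvature_eq hg hx]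
  simp only [quadModel]
  ring

end MetricApprox

end AsymptoticallyFlat

namespace AsymptoticallyFlat

/-! ### Polarization of the quadratic terms -/

/-- The part of `quadModel` that is bilinear in `h` and in the second derivatives. -/
def quadModelZeroTwo (h : Fin 3 → Fin 3 → ℝ) (H : Fin 3 → Fin 3 → Fin 3 → Fin 3 → ℝ) : ℝ :=
  ∑ i, ∑ j, ∑ l, (1 / 2) * (h j l * (chr (H i) l j i - chr (H j) l i i)) -
    ∑ i, ∑ j, h i j * linRicci H i j

/-- The part of `quadModel` that is quadratic in the first derivatives. -/
def quadModelOne (P : Fin 3 → Fin 3 → Fin 3 → ℝ) : ℝ :=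
  ∑ i, ∑ j, ∑ l, (1 / 2) * (P i j l * chr P l j i - P j j l * chr P l i i) +
    (1 / 4) * ∑ i, ∑ j, ∑ m, (chr P m i i * chr P j j m - chr P m j i * chr P j i m)

lemma quadModel_eq (h : Fin 3 → Fin 3 → ℝ) (P : Fin 3 → Fin 3 → Fin 3 → ℝ)
    (H : Fin 3 → Fin 3 → Fin 3 → Fin 3 → ℝ) :
    quadModel h P H = quadModelZeroTwo h H + quadModelOne P := by
  have h1 : ∀ i j l, ((1 / 2) * (-P j j l * chr P l i i - h j l * chr (H j) l i i) -
    (1 / 2) * (-P i j l * chr P l j i - h j l * chr (H i) l j i)) =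
    (1 / 2) * (h j l * (chr (H i) l j i - chr (H j) l i i)) +
    (1 / 2) * (P i j l * chr P l j i - P j j l * chr P l i i) := fun i j l => by ring
  have h2 : ∀ i j m, (1 / 2) * chr P m i i * ((1 / 2) * chr P j j m) -
      (1 / 2) * chr P m j i * ((1 / 2) * chr P j i m) =
      (1 / 4) * (chr P m i i * chr P j j m - chr P m j i * chr P j i m) := fun i j m => by ring
  simp only [quadModel, quad, quadModelZeroTwo, quadModelOne, h1, h2, Finset.sum_add_distrib,
    ← Finset.mul_sum]
  ring

-- For a quadratic form, `Q(u + v) - Q(u - v)` is four times the symmetric bilinear form at `(u,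
-- v)`. Here `u` is a conformal perturbation and `v` a general symmetric one; the interaction
-- collapses to the gradient of the conformal factor paired with the gradient of the trace.
set_option maxHeartbeats 4000000 in
lemma quadModelOne_polarization (p : Fin 3 → ℝ) (d : Fin 3 → Fin 3 → Fin 3 → ℝ)
    (hd : ∀ k i j, d k i j = d k j i) :
    quadModelOne (fun k i j => p k * kd i j + d k i j) -
      quadModelOne (fun k i j => p k * kd i j - d k i j) = 2 * ∑ k, p k * ∑ i, d k i i := by
  have h1 : ∀ k, d k 1 0 = d k 0 1 := fun k => hd k 1 0
  have h2 : ∀ k, d k 2 0 = d k 0 2 := fun k => hd k 2 0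
  have h3 : ∀ k, d k 2 1 = d k 1 2 := fun k => hd k 2 1
  simp only [quadModelOne, chr, Fin.sum_univ_three, kd, h1, h2, h3, Fin.reduceEq, if_true, if_false,
    mul_one, mul_zero, zero_add, zero_sub]
  ring

-- The companion for the terms `h ∂²h`. The right-hand side isolates the trace of the Hessian `η`
-- and `linScalar d`, both of which vanish for `1/r` and `σ`.
set_option maxHeartbeats 4000000 in
lemma quadModelZeroTwo_polarization (a : ℝ) (η s : Fin 3 → Fin 3 → ℝ)
    (d : Fin 3 → Fin 3 → Fin 3 → Fin 3 → ℝ) (hη : ∀ i j, η i j = η j i)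
    (hs : ∀ i j, s i j = s j i) (hd : ∀ m k i j, d m k i j = d m k j i) :
    quadModelZeroTwo (fun i j => a * kd i j + s i j) (fun m k i j => η m k * kd i j + d m k i j) -
    quadModelZeroTwo (fun i j => a * kd i j - s i j) (fun m k i j => η m k * kd i j - d m k i j) =
      2 * (∑ i, ∑ j, s i j * η i j + (∑ i, s i i) * ∑ i, η i i - 2 * a * linScalar d) := by
  have h1 : ∀ m k, d m k 1 0 = d m k 0 1 := fun m k => hd m k 1 0
  have h2 : ∀ m k, d m k 2 0 = d m k 0 2 := fun m k => hd m k 2 0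
  have h3 : ∀ m k, d m k 2 1 = d m k 1 2 := fun m k => hd m k 2 1
  simp only [quadModelZeroTwo, linRicci, linScalar, chr, Fin.sum_univ_three, kd, h1, h2, h3,
    hη 1 0, hη 2 0, hη 2 1, hs 1 0, hs 2 0, hs 2 1, Fin.reduceEq, if_true, if_false, mul_one,
    mul_zero, zero_add, zero_sub]
  ring

/-! ### The leading term of the metric -/

/-- The Newtonian potential `1 / r`. -/
def newton (x : E3) : ℝ := ‖x‖⁻¹

/-- The tensor `σ` for `α = x₁ / r`. -/
def sig (i j : Fin 3) (x : E3) : ℝ := sigma (fun y => y 0 / ‖y‖) i j x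

lemma sig_eq (i j : Fin 3) (x : E3) :
    sig i j x = x 0 * (x i * (x j * newton x ^ 4)) - (1 / 2) * kd i j * (x 0 * newton x ^ 2) := by
  simp only [sig, sigma, newton, div_eq_mul_inv]
  ring

lemma sig_symm (i j : Fin 3) (x : E3) : sig i j x = sig j i x := by
  simp only [sig_eq, kd, eq_comm (a := i)]
  ring

lemma newton_neg (x : E3) : newton (-x) = newton x := by simp [newton]

lemma sig_neg (i j : Fin 3) (x : E3) : sig i j (-x) = -sig i j x := by
  simp only [sig_eq, newton_neg, PiLp.neg_apply]
  ring

lemma newton_sq_mul {x : E3} (hx : x ≠ 0) :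
    newton x ^ 2 * (x 0 ^ 2 + x 1 ^ 2 + x 2 ^ 2) = 1 := by
  have h1 : ‖x‖ ^ 2 = x 0 ^ 2 + x 1 ^ 2 + x 2 ^ 2 := by
    rw [EuclideanSpace.norm_sq_eq]
    simp [Fin.sum_univ_three]
  have h2 : ‖x‖ ≠ 0 := norm_ne_zero_iff.2 hx
  rw [← h1, newton, inv_pow, inv_mul_cancel₀ (pow_ne_zero 2 h2)]

lemma homog_newton : Homog 1 newton := by
  intro c hc x
  simp [newton, norm_smul, abs_of_pos hc, mul_comm]

lemma homog_sig (i j : Fin 3) : Homog 1 (sig i j) := by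
  intro c hc x
  simp only [sig_eq, homog_newton c hc x, PiLp.smul_apply, smul_eq_mul, pow_one]
  field_simp

lemma contDiffOn_newton (n : WithTop ℕ∞) : ContDiffOn ℝ n newton {0}ᶜ := by
  intro x hx
  exact ((contDiffAt_norm ℝ hx).inv (norm_ne_zero_iff.2 hx)).contDiffWithinAt

lemma contDiffOn_sig (n : WithTop ℕ∞) (i j : Fin 3) : ContDiffOn ℝ n (sig i j) {0}ᶜ := by
  have h := contDiffOn_newton n
  rw [show sig i j = _ from funext (sig_eq i j)]
  have hc : ∀ k : Fin 3, ContDiffOn ℝ n (fun x : E3 => x k) {0}ᶜ := fun k => by fun_prop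
  exact ((hc 0).mul ((hc i).mul ((hc j).mul (h.pow 4)))).sub
    (contDiffOn_const.mul ((hc 0).mul (h.pow 2)))

lemma compl_zero_mem_nhds {x : E3} (hx : x ≠ 0) : ({0}ᶜ : Set E3) ∈ 𝓝 x :=
  isOpen_compl_singleton.mem_nhds hx

lemma differentiableAt_of_contDiffOn_compl {f : E3 → ℝ} (hf : ContDiffOn ℝ 1 f {0}ᶜ) {x : E3}
    (hx : x ≠ 0) : DifferentiableAt ℝ f x :=
  (hf.contDiffAt (compl_zero_mem_nhds hx)).differentiableAt one_ne_zero

lemma differentiableAt_newton {x : E3} (hx : x ≠ 0) : DifferentiableAt ℝ newton x :=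
  differentiableAt_of_contDiffOn_compl (contDiffOn_newton 1) hx

lemma differentiableAt_coord (i : Fin 3) (x : E3) : DifferentiableAt ℝ (fun y : E3 => y i) x := by
  fun_prop

/-- Obtained by differentiating `newton² ‖y‖² = 1`, so that only the smooth function `‖y‖²` has to
be differentiated directly. -/
lemma pd_newton {x : E3} (hx : x ≠ 0) (k : Fin 3) : pd k newton x = -x k * newton x ^ 3 := by
  have h0 : ‖x‖ ≠ 0 := norm_ne_zero_iff.2 hx
  have h1 : HasFDerivAt (fun y : E3 => ‖y‖ ^ 2) (2 • innerSL ℝ x) x :=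
    (hasStrictFDerivAt_norm_sq x).hasFDerivAt
  have h2 : pd k (fun y : E3 => ‖y‖ ^ 2) x = 2 * x k := by
    simp [pd, h1.fderiv, EuclideanSpace.inner_single_right]
  have hn := differentiableAt_newton hx
  have h3 : pd k (fun y : E3 => newton y ^ 2 * ‖y‖ ^ 2) x = 0 := by
    rw [← pd_const 1 x k]
    refine pd_congr ?_ k
    filter_upwards [compl_zero_mem_nhds hx] with y hy
    rw [newton, inv_pow, inv_mul_cancel₀ (pow_ne_zero 2 (norm_ne_zero_iff.2 hy))]
  rw [pd_mul (hn.fun_pow 2) h1.differentiableAt, h2, pd_pow hn] at h3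
  have h4 : ‖x‖ * newton x = 1 := mul_inv_cancel₀ h0
  simp only [Nat.add_one_sub_one, pow_one] at h3
  push_cast at h3
  linear_combination (newton x / 2) * h3 - pd k newton x * (‖x‖ * newton x + 1) * h4

lemma pd_newton_pow {x : E3} (hx : x ≠ 0) (k : Fin 3) (n : ℕ) :
    pd k (fun y => newton y ^ n) x = -n * x k * newton x ^ (n + 2) := by
  rcases n with _ | n
  · simp [pd_const]
  · rw [pd_pow (differentiableAt_newton hx), pd_newton hx]
    simp only [Nat.add_one_sub_one]
    push_cast
    ring

lemma pd_pd_newton {x : E3} (hx : x ≠ 0) (m k : Fin 3) :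
    pd m (pd k newton) x = -kd k m * newton x ^ 3 + 3 * x k * x m * newton x ^ 5 := by
  have h1 : pd k newton =ᶠ[𝓝 x] fun y => -1 * (y k * newton y ^ 3) := by
    filter_upwards [compl_zero_mem_nhds hx] with y hy
    rw [pd_newton hy]
    ring
  have hn := (differentiableAt_newton hx).fun_pow 3
  rw [pd_congr h1, pd_const_mul ((differentiableAt_coord k x).fun_mul hn),
    pd_mul (differentiableAt_coord k x) hn, pd_newton_pow hx, pd_coord]
  push_cast
  ring

lemma pd_sig {x : E3} (hx : x ≠ 0) (k i j : Fin 3) :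
    pd k (sig i j) x = (kd 0 k * x i * x j + x 0 * kd i k * x j + x 0 * x i * kd j k) * newton x ^ 4
      - 4 * x 0 * x i * x j * x k * newton x ^ 6
      - (1 / 2) * kd i j * (kd 0 k * newton x ^ 2 - 2 * x 0 * x k * newton x ^ 4) := by
  have hn := fun n => (differentiableAt_newton hx).fun_pow n
  have hc := fun i => differentiableAt_coord i x
  rw [show sig i j = _ from funext (sig_eq i j)]
  rw [pd_sub ((hc 0).fun_mul ((hc i).fun_mul ((hc j).fun_mul (hn 4))))
      (((hc 0).fun_mul (hn 2)).const_mul _),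
    pd_const_mul ((hc 0).fun_mul (hn 2)), pd_mul (hc 0) (hn 2),
    pd_mul (hc 0) ((hc i).fun_mul ((hc j).fun_mul (hn 4))),
    pd_mul (hc i) ((hc j).fun_mul (hn 4)), pd_mul (hc j) (hn 4), pd_newton_pow hx,
    pd_newton_pow hx]
  simp only [pd_coord]
  push_cast
  ring

lemma sum_pd_sig {x : E3} (hx : x ≠ 0) (j : Fin 3) :
    ∑ i, (pd i (sig i j) x - pd j (sig i i) x) = x 0 * (x j * newton x ^ 4) := by
  have h := newton_sq_mul hx
  simp only [pd_sig hx, Fin.sum_univ_three, kd]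
  fin_cases j <;> simp <;> first
    | linear_combination (-newton x ^ 2) * h
    | ring

/-- By `sum_pd_sig` this is the divergence of `x₁ r⁻⁴ x`, a function of degree `-3` times the
position vector; by Euler's relation it vanishes in dimension three. Thus `σ` is a solution of the
linearised equation. -/
lemma linScalar_sig {x : E3} (hx : x ≠ 0) :
    linScalar (fun m k i j => pd m (pd k (sig i j)) x) = 0 := by
  have h := newton_sq_mul hx
  have hd : ∀ k i j, DifferentiableAt ℝ (pd k (sig i j)) x := fun k i j =>
    differentiableAt_of_contDiffOn_compl
      (contDiffOn_pd isOpen_compl_singleton (contDiffOn_sig 2 i j) k) hx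
  have h1 : ∀ j, ∑ i, (pd j (pd i (sig i j)) x - pd j (pd j (sig i i)) x) =
      kd 0 j * x j * newton x ^ 4 + x 0 * newton x ^ 4 - 4 * x 0 * x j ^ 2 * newton x ^ 6 := by
    intro j
    have h2 : ∑ i, (pd j (pd i (sig i j)) x - pd j (pd j (sig i i)) x) =
        pd j (fun y => ∑ i, (pd i (sig i j) y - pd j (sig i i) y)) x := by
      rw [pd_sum fun i _ => (hd i i j).fun_sub (hd j i i)]
      exact Finset.sum_congr rfl fun i _ => (pd_sub (hd i i j) (hd j i i) j).symm
    have h3 : (fun y => ∑ i, (pd i (sig i j) y - pd j (sig i i) y)) =ᶠ[𝓝 x]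
        fun y => y 0 * (y j * newton y ^ 4) := by
      filter_upwards [compl_zero_mem_nhds hx] with y hy
      exact sum_pd_sig hy j
    have hn := (differentiableAt_newton hx).fun_pow 4
    have hc := fun i => differentiableAt_coord i x
    rw [h2, pd_congr h3, pd_mul (hc 0) ((hc j).fun_mul hn), pd_mul (hc j) hn, pd_newton_pow hx,
      pd_coord, pd_coord]
    simp only [kd, if_true]
    push_cast
    ring
  simp only [linScalar, h1, Fin.sum_univ_three, kd]
  simp
  linear_combination (-4 * x 0 * newton x ^ 4) * h

/-- The leading terms of `g - δ`. -/
def modelZero (A : ℝ) (x : E3) (i j : Fin 3) : ℝ := A * newton x * kd i j + sig i j x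

/-- The first derivatives of `modelZero`. -/
def modelOne (A : ℝ) (x : E3) (k i j : Fin 3) : ℝ := A * pd k newton x * kd i j + pd k (sig i j) x

/-- The second derivatives of `modelZero`. -/
def modelTwo (A : ℝ) (x : E3) (m k i j : Fin 3) : ℝ :=
  A * pd m (pd k newton) x * kd i j + pd m (pd k (sig i j)) x

lemma quadModelOne_neg (P : Fin 3 → Fin 3 → Fin 3 → ℝ) :
    quadModelOne (fun k i j => -P k i j) = quadModelOne P := by
  have h1 : ∀ l i j, chr (fun k i j => -P k i j) l i j = -chr P l i j := fun l i j => by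
    simp only [chr]; ring
  simp only [quadModelOne, h1, neg_mul_neg]

/-- The odd part of the quadratic terms is the interaction of `A / r` with `σ`. -/
lemma quadModel_model_sub_neg (A : ℝ) {x : E3} (hx : x ≠ 0) :
    quadModel (modelZero A x) (modelOne A x) (modelTwo A x) -
      quadModel (modelZero A (-x)) (modelOne A (-x)) (modelTwo A (-x)) =
      3 * A * x 0 * newton x ^ 5 := by
  have h0 : modelZero A (-x) = fun i j => A * newton x * kd i j - sig i j x := by
    ext i j
    simp only [modelZero, newton_neg, sig_neg]
    ring
  -- Differentiation flips parity, so the reflection changes the sign of the Newtonian part here.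
  -- The overall minus is invisible to the quadratic `quadModelOne`, and what remains is again the
  -- model with `σ` replaced by `-σ`.
  have h1 : modelOne A (-x) =
      fun k i j => -(A * pd k newton x * kd i j - pd k (sig i j) x) := by
    ext k i j
    simp only [modelOne, pd_even newton_neg, pd_odd (sig_neg i j)]
    ring
  have h2 : modelTwo A (-x) =
      fun m k i j => A * pd m (pd k newton) x * kd i j - pd m (pd k (sig i j)) x := by
    ext m k i j
    simp only [modelTwo, pd_odd (pd_even newton_neg k), pd_even (pd_odd (sig_neg i j) k)]
    ring
  have hs : ∀ i j, sig i j = sig j i := fun i j => funext (sig_symm i j)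
  have hp1 := quadModelOne_polarization (fun k => A * pd k newton x) (fun k i j => pd k (sig i j) x)
    (fun k i j => by simp only [hs i j])
  have hp2 := quadModelZeroTwo_polarization (A * newton x) (fun m k => A * pd m (pd k newton) x)
    (fun i j => sig i j x) (fun m k i j => pd m (pd k (sig i j)) x)
    (fun i j => by simp only [pd_pd_newton hx, kd, eq_comm (a := i)]; ring)
    (fun i j => sig_symm i j x) (fun m k i j => by simp only [hs i j])
  have h := newton_sq_mul hx
  -- The interaction in units of `A x₁ r⁻⁵`: `e1` gives `2 · 2`, `e3` gives `2 · (-1/2)`, and the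
  -- trace term drops out by `e2`, the harmonicity of `1/r`. The total is `3`.
  have e1 : ∑ i, ∑ j, sig i j x * (A * pd i (pd j newton) x) = 2 * A * x 0 * newton x ^ 5 := by
    simp only [pd_pd_newton hx, sig_eq, Fin.sum_univ_three, kd]
    simp
    linear_combination (A * x 0 * newton x ^ 5 *
      (3 * (newton x ^ 2 * (x 0 ^ 2 + x 1 ^ 2 + x 2 ^ 2)) + 1 / 2)) * h
  have e2 : ∑ i, A * pd i (pd i newton) x = 0 := by
    simp only [pd_pd_newton hx, Fin.sum_univ_three, kd]
    simp
    linear_combination (3 * A * newton x ^ 3) * h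
  have e3 : ∑ k, A * pd k newton x * ∑ i, pd k (sig i i) x = -(1 / 2) * A * x 0 * newton x ^ 5 := by
    simp only [pd_newton hx, pd_sig hx, Fin.sum_univ_three, kd]
    simp
    linear_combination (A * x 0 * newton x ^ 5 *
      (4 * (newton x ^ 2 * (x 0 ^ 2 + x 1 ^ 2 + x 2 ^ 2)) - 2)) * h
  rw [linScalar_sig hx, e1, e2] at hp2
  rw [e3] at hp1
  rw [quadModel_eq, quadModel_eq, h0, h1, h2, quadModelOne_neg]
  change quadModelZeroTwo (fun i j => A * newton x * kd i j + sig i j x)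
    (fun m k i j => A * pd m (pd k newton) x * kd i j + pd m (pd k (sig i j)) x) +
    quadModelOne (fun k i j => A * pd k newton x * kd i j + pd k (sig i j) x) - _ = _
  linear_combination hp1 + hp2

end AsymptoticallyFlat

namespace AsymptoticallyFlat

open Asymptotics Bornology

/-! ### The given asymptotics as leading terms of the metric and its derivatives -/

lemma ne_zero_of_mem_exterior {R₀ : ℝ} (hR₀ : 0 < R₀) {x : E3} (hx : x ∈ exterior R₀) : x ≠ 0 :=
  norm_pos_iff.1 (hR₀.trans hx)

lemma pd_add_const (f : E3 → ℝ) (c : ℝ) (x : E3) (k : Fin 3) :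
    pd k (fun y => f y + c) x = pd k f x := by
  simp [pd, fderiv_add_const]

lemma pd_modelZero (A : ℝ) {x : E3} (hx : x ≠ 0) (k i j : Fin 3) :
    pd k (fun y => modelZero A y i j) x = modelOne A x k i j := by
  have hn := differentiableAt_newton hx
  have hs := differentiableAt_of_contDiffOn_compl (contDiffOn_sig 1 i j) hx
  simp only [modelZero, modelOne]
  rw [pd_add ((hn.const_mul A).mul_const _) hs, pd_mul_const (hn.const_mul A), pd_const_mul hn]

lemma contDiffOn_modelZero (A : ℝ) (i j : Fin 3) :
    ContDiffOn ℝ 2 (fun x => modelZero A x i j) {0}ᶜ :=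
  ((contDiffOn_const.mul (contDiffOn_newton 2)).mul contDiffOn_const).add (contDiffOn_sig 2 i j)

lemma contDiffOn_modelOne (A : ℝ) (k i j : Fin 3) :
    ContDiffOn ℝ 1 (fun x => modelOne A x k i j) {0}ᶜ :=
  ((contDiffOn_const.mul (contDiffOn_pd isOpen_compl_singleton (contDiffOn_newton 2) k)).mul
    contDiffOn_const).add (contDiffOn_pd isOpen_compl_singleton (contDiffOn_sig 2 i j) k)

lemma pd_modelOne (A : ℝ) {x : E3} (hx : x ≠ 0) (m k i j : Fin 3) :
    pd m (fun y => modelOne A y k i j) x = modelTwo A x m k i j := by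
  have hn := differentiableAt_of_contDiffOn_compl
    (contDiffOn_pd isOpen_compl_singleton (contDiffOn_newton 2) k) hx
  have hs := differentiableAt_of_contDiffOn_compl
    (contDiffOn_pd isOpen_compl_singleton (contDiffOn_sig 2 i j) k) hx
  simp only [modelOne, modelTwo]
  rw [pd_add ((hn.const_mul A).mul_const _) hs, pd_mul_const (hn.const_mul A), pd_const_mul hn]

lemma Homog.linear {n : ℕ} {f g : E3 → ℝ} (hf : Homog n f) (hg : Homog n g) (A c : ℝ) :
    Homog n fun x => A * f x * c + g x := by
  intro a ha x
  simp only [hf a ha, hg a ha]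
  ring

lemma continuousOn_pd_compl {f : E3 → ℝ} (hf : ContDiffOn ℝ 1 f {0}ᶜ) (k : Fin 3) :
    ContinuousOn (pd k f) {0}ᶜ :=
  (hf.continuousOn_fderiv_of_isOpen isOpen_compl_singleton le_rfl).clm_apply continuousOn_const

lemma dec_modelZero (A : ℝ) (i j : Fin 3) : Dec 1 fun x => modelZero A x i j := by
  have h : Homog 1 fun x => modelZero A x i j := homog_newton.linear (homog_sig i j) A _
  simpa using h.dec (contDiffOn_modelZero A i j).continuousOn

lemma dec_modelOne (A : ℝ) (k i j : Fin 3) : Dec 2 fun x => modelOne A x k i j := by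
  have h : Homog 2 fun x => modelOne A x k i j :=
    (homog_newton.pd k).linear ((homog_sig i j).pd k) A _
  simpa using h.dec (contDiffOn_modelOne A k i j).continuousOn

lemma dec_modelTwo (A : ℝ) (m k i j : Fin 3) : Dec 3 fun x => modelTwo A x m k i j := by
  have h : Homog 3 fun x => modelTwo A x m k i j :=
    ((homog_newton.pd k).pd m).linear (((homog_sig i j).pd k).pd m) A _
  have hc : ContinuousOn (fun x => modelTwo A x m k i j) {0}ᶜ :=
    (continuousOn_pd_compl (contDiffOn_modelOne A k i j) m).congr fun x hx =>
      (pd_modelOne A hx m k i j).symm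
  simpa using h.dec hc

variable {g : E3 → Matrix (Fin 3) (Fin 3) ℝ} {R₀ q A : ℝ}

lemma metricApprox (hR₀ : 0 < R₀) (hg : IsRiemannianMetricOn g (exterior R₀))
    (h : HasAsymptotics g A (fun x => x 0 / ‖x‖) q) :
    MetricApprox q g (modelZero A) (modelOne A) (modelTwo A) := by
  -- The constant `δᵢⱼ` is kept as a separate summand so that it disappears under differentiation.
  have he : ∀ i j, (fun x => g x i j - ((1 + A / ‖x‖) * kd i j + sigma (fun x => x 0 / ‖x‖) i j x))
      = fun x => (g x i j - modelZero A x i j) + -kd i j := by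
    intro i j
    ext x
    simp only [modelZero, sig, newton]
    ring
  have hmd : ∀ {x : E3}, x ∈ exterior R₀ → ∀ i j,
      DifferentiableAt ℝ (fun y => modelZero A y i j) x := fun hx i j =>
    differentiableAt_of_contDiffOn_compl ((contDiffOn_modelZero A i j).of_le one_le_two)
      (ne_zero_of_mem_exterior hR₀ hx)
  have h1 : ∀ {x : E3}, x ∈ exterior R₀ → ∀ k i j,
      pd k (fun x => (g x i j - modelZero A x i j) + -kd i j) x =
        dg g x k i j - modelOne A x k i j := by
    intro x hx k i j
    rw [pd_add_const, pd_sub (hg.differentiableAt hx i j) (hmd hx i j),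
      pd_modelZero A (ne_zero_of_mem_exterior hR₀ hx), dg]
  have h2 : ∀ {x : E3}, x ∈ exterior R₀ → ∀ m k i j,
      pd m (pd k fun x => (g x i j - modelZero A x i j) + -kd i j) x =
        ddg g x m k i j - modelTwo A x m k i j := by
    intro x hx m k i j
    have hx0 := ne_zero_of_mem_exterior hR₀ hx
    have h3 : (pd k fun x => (g x i j - modelZero A x i j) + -kd i j) =ᶠ[𝓝 x]
        fun y => pd k (fun z => g z i j) y - modelOne A y k i j := by
      filter_upwards [(isOpen_exterior R₀).mem_nhds hx] with y hy
      exact h1 hy k i j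
    rw [pd_congr h3, pd_sub (hg.differentiableAt_pd hx i j k)
      (differentiableAt_of_contDiffOn_compl (contDiffOn_modelOne A k i j) hx0),
      pd_modelOne A hx0, ddg]
  have hb : ∀ i j, ∃ C R : ℝ, ∀ x : E3, R < ‖x‖ →
    |(g x i j - modelZero A x i j) + -kd i j| ≤ C * ‖x‖ ^ (-(1 + q)) ∧
    (∀ k, |pd k (fun x => (g x i j - modelZero A x i j) + -kd i j) x| ≤
      C * ‖x‖ ^ (-(1 + q) - 1)) ∧
    (∀ m k, |pd m (pd k fun x => (g x i j - modelZero A x i j) + -kd i j) x| ≤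
      C * ‖x‖ ^ (-(1 + q) - 2)) := by
    intro i j
    have := h i j
    rw [he] at this
    exact this
  refine ⟨fun i j => ⟨dec_modelZero A i j, ?_⟩, fun k i j => ⟨dec_modelOne A k i j, ?_⟩,
    fun m k i j => ⟨dec_modelTwo A m k i j, ?_⟩⟩ <;> obtain ⟨C, R, hC⟩ := hb i j
  · refine (dec_of_bound fun x hx => (hC x hx).1).congr (Eventually.of_forall fun x => ?_)
    ring
  · refine Dec.congr (f := pd k fun x => (g x i j - modelZero A x i j) + -kd i j)
      (dec_of_bound (C := C) (R := R) fun x hx => ?_) ?_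
    · convert (hC x hx).2.1 k using 3
      ring
    · filter_upwards [eventually_lt_norm R₀] with x hx using h1 hx k i j
  · refine Dec.congr (f := pd m (pd k fun x => (g x i j - modelZero A x i j) + -kd i j))
      (dec_of_bound (C := C) (R := R) fun x hx => ?_) ?_
    · convert (hC x hx).2.2 m k using 3
      ring
    · filter_upwards [eventually_lt_norm R₀] with x hx using h2 hx m k i j

/-! ### Surface integrals -/

lemma sphereIntegral_congr {f f' : E3 → ℝ} {ρ : ℝ} (hR₀ : 0 < R₀) (hρ : R₀ < ρ)
    (h : ∀ x ∈ exterior R₀, f x = f' x) : sphereIntegral f ρ = sphereIntegral f' ρ := by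
  unfold sphereIntegral
  congr 2
  ext ω
  exact h _ (smul_mem_exterior hR₀ hρ ω)

lemma sphereIntegral_add {f f' : E3 → ℝ} {ρ : ℝ} (hR₀ : 0 < R₀) (hρ : R₀ < ρ)
    (hf : ContinuousOn f (exterior R₀)) (hf' : ContinuousOn f' (exterior R₀)) :
    sphereIntegral (fun x => f x + f' x) ρ = sphereIntegral f ρ + sphereIntegral f' ρ := by
  unfold sphereIntegral
  rw [integral_add (integrable_sphere_comp hR₀ hρ hf) (integrable_sphere_comp hR₀ hρ hf'), mul_add]

lemma sphereIntegral_const_mul (c : ℝ) (f : E3 → ℝ) (ρ : ℝ) :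
    sphereIntegral (fun x => c * f x) ρ = c * sphereIntegral f ρ := by
  unfold sphereIntegral
  rw [integral_const_mul]
  ring

lemma sphereIntegral_comp_neg (f : E3 → ℝ) (ρ : ℝ) :
    sphereIntegral (fun x => f (-x)) ρ = sphereIntegral f ρ := by
  unfold sphereIntegral
  have h := integral_sphereMap (LinearIsometryEquiv.neg ℝ) (fun x => f (ρ • x))
  simp only [LinearIsometryEquiv.coe_neg, smul_neg] at h
  exact congrArg (ρ ^ 2 * ·) h

lemma sphereIntegral_bound {a : ℝ} {f : E3 → ℝ} (hf : Dec a f) :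
    ∃ C R : ℝ, 0 < R ∧ ∀ ρ, R < ρ → |sphereIntegral f ρ| ≤ C * ρ ^ (2 - a) := by
  obtain ⟨C, R, hR, -, hC⟩ := hf.exists_bound
  refine ⟨C * sphereMeasure.real Set.univ, R, hR, fun ρ hρ => ?_⟩
  have hρ0 : 0 < ρ := hR.trans hρ
  have h1 : ‖∫ ω : Metric.sphere (0 : E3) 1, f (ρ • (ω : E3)) ∂sphereMeasure‖ ≤
      C * ρ ^ (-a) * sphereMeasure.real Set.univ := by
    refine norm_integral_le_of_norm_le_const (Eventually.of_forall fun ω => ?_)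
    have := hC (ρ • (ω : E3)) (smul_mem_exterior hR hρ ω)
    simpa [norm_smul, abs_of_pos hρ0] using this
  rw [sphereIntegral, abs_mul, abs_of_nonneg (sq_nonneg ρ)]
  have h2 : ρ ^ (2 - a) = ρ ^ 2 * ρ ^ (-a) := by
    rw [← Real.rpow_natCast, ← Real.rpow_add hρ0]
    congr 1
  rw [h2]
  calc _ ≤ ρ ^ 2 * (C * ρ ^ (-a) * sphereMeasure.real Set.univ) :=
        mul_le_mul_of_nonneg_left h1 (sq_nonneg ρ)
    _ = _ := by ring

lemma sphereIntegral_eq_of_homogeneous {f : E3 → ℝ} {n : ℕ} (hf : Homog n f) {ρ : ℝ} (hρ : 0 < ρ) :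
    sphereIntegral f ρ = ρ ^ 2 * (ρ ^ n)⁻¹ * ∫ ω, f (ω : E3) ∂sphereMeasure := by
  simp only [sphereIntegral, hf ρ hρ, integral_const_mul]
  ring

end AsymptoticallyFlat

namespace AsymptoticallyFlat

open Asymptotics Bornology

variable {g : E3 → Matrix (Fin 3) (Fin 3) ℝ} {R₀ q A : ℝ}

lemma exterior_subset_compl_zero (hR₀ : 0 < R₀) : exterior R₀ ⊆ ({0}ᶜ : Set E3) :=
  fun _ hx => ne_zero_of_mem_exterior hR₀ hx

lemma continuousOn_newton (hR₀ : 0 < R₀) : ContinuousOn newton (exterior R₀) :=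
  (contDiffOn_newton 0).continuousOn.mono (exterior_subset_compl_zero hR₀)

lemma continuousOn_coord (i : Fin 3) (s : Set E3) : ContinuousOn (fun x : E3 => x i) s := by
  fun_prop

/-! ### The energy -/

/-- The total area of the unit sphere. -/
def sphereArea : ℝ := sphereMeasure.real Set.univ

lemma sphereArea_pos : 0 < sphereArea := by
  have : NeZero sphereMeasure := ⟨Measure.toSphere_ne_zero _⟩
  exact measureReal_univ_pos

/-- The energy density as a linear function of the first derivatives of the metric. -/
def energyForm (P : E3 → Fin 3 → Fin 3 → Fin 3 → ℝ) (x : E3) : ℝ :=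
  ∑ i, ∑ j, (P x i i j - P x j i i) * (x j * newton x)

lemma energyDensity_eq (x : E3) : energyDensity g x = energyForm (dg g) x := rfl

/-- The contribution `x₁/r³` of `σ` is odd and so is invisible to the energy; only `2A/r²` survives
integration. -/
lemma energyForm_model {x : E3} (hx : x ≠ 0) :
    energyForm (modelOne A) x = 2 * A * newton x ^ 2 + x 0 * newton x ^ 3 := by
  have h := newton_sq_mul hx
  have h1 := sum_pd_sig hx
  have h2 : energyForm (modelOne A) x = ∑ j, (∑ i, (pd i (sig i j) x - pd j (sig i i) x)) *
      (x j * newton x) + A * ∑ j, (∑ i, (pd i newton x * kd i j - pd j newton x * kd i i)) *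
      (x j * newton x) := by
    simp only [energyForm, modelOne]
    rw [Finset.sum_comm]
    simp only [Finset.mul_sum, Finset.sum_mul, ← Finset.sum_add_distrib]
    refine Finset.sum_congr rfl fun j _ => Finset.sum_congr rfl fun i _ => ?_
    ring
  rw [h2]
  simp only [h1, pd_newton hx, Fin.sum_univ_three, kd]
  simp
  linear_combination (2 * A * newton x ^ 2 + x 0 * newton x ^ 3) * h

lemma IsRiemannianMetricOn.continuousOn_dg (hg : IsRiemannianMetricOn g (exterior R₀))
    (k i j : Fin 3) : ContinuousOn (fun x => dg g x k i j) (exterior R₀) :=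
  (hg.contDiffOn_pd i j k).continuousOn

lemma continuousOn_energyDensity (hR₀ : 0 < R₀) (hg : IsRiemannianMetricOn g (exterior R₀)) :
    ContinuousOn (energyDensity g) (exterior R₀) :=
  continuousOn_finsetSum _ fun i _ => continuousOn_finsetSum _ fun j _ =>
    ((hg.continuousOn_dg i i j).sub (hg.continuousOn_dg j i i)).mul
      ((continuousOn_coord j _).mul (continuousOn_newton hR₀))

lemma dec_coord (i : Fin 3) : Dec (-1) fun x => x i := by
  refine dec_of_bound (C := 1) (R := 0) fun x _ => ?_
  simpa using EuclideanSpace.norm_eq x ▸ PiLp.norm_apply_le x i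

lemma dec_newton : Dec 1 newton := by
  simpa using homog_newton.dec (contDiffOn_newton 0).continuousOn

/-- The leading density is homogeneous of degree `-2`, so its flux does not depend on the radius,
and the error contributes `O(ρ^{-q})`. As the unit sphere has area `4π`, the limit is `A/2`. -/
lemma hasEnergy_of_asymptotics (hR₀ : 0 < R₀) (hq : 0 < q)
    (hg : IsRiemannianMetricOn g (exterior R₀))
    (hA : MetricApprox q g (modelZero A) (modelOne A) (modelTwo A)) :
    HasEnergy g (1 / (16 * Real.pi) * (2 * A * sphereArea)) := by
  have hrem : Dec (2 + q) fun x => energyForm (dg g) x - energyForm (modelOne A) x := by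
    have hn : ∀ j, Approx q 0 (fun x : E3 => x j * newton x) (fun x => x j * newton x) := by
      intro j
      refine ⟨by simpa using (dec_coord j).mul dec_newton, ?_⟩
      simpa using Dec.zero (0 + q)
    have h1 : Approx q 2 (energyForm (dg g)) (energyForm (modelOne A)) :=
      Approx.sum fun i _ => Approx.sum fun j _ =>
        (((hA.one i i j).sub (hA.one j i i)).mul hq.le (hn j)).cast (by norm_num)
    exact h1.rem
  have hc1 : ContinuousOn (fun x => 2 * A * newton x ^ 2) (exterior R₀) :=
    continuousOn_const.mul ((continuousOn_newton hR₀).pow 2)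
  have hc2 : ContinuousOn (fun x : E3 => x 0 * newton x ^ 3) (exterior R₀) :=
    (continuousOn_coord 0 _).mul ((continuousOn_newton hR₀).pow 3)
  have hc3 : ContinuousOn (fun x => energyForm (dg g) x - energyForm (modelOne A) x)
      (exterior R₀) :=
    (continuousOn_energyDensity hR₀ hg).sub ((hc1.add hc2).congr fun x hx =>
      energyForm_model (ne_zero_of_mem_exterior hR₀ hx))
  have hsplit : ∀ ρ, R₀ < ρ → sphereIntegral (energyDensity g) ρ = 2 * A * sphereArea +
      sphereIntegral (fun x => energyForm (dg g) x - energyForm (modelOne A) x) ρ := by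
    intro ρ hρ
    have hρ0 : 0 < ρ := hR₀.trans hρ
    have e0 : ∀ x ∈ exterior R₀, energyDensity g x = 2 * A * newton x ^ 2 +
        x 0 * newton x ^ 3 + (energyForm (dg g) x - energyForm (modelOne A) x) := by
      intro x hx
      rw [energyForm_model (ne_zero_of_mem_exterior hR₀ hx), energyDensity_eq]
      ring
    have h1 : Homog 2 fun x => 2 * A * newton x ^ 2 := by
      intro c hc x
      simp only [homog_newton c hc x]
      ring
    have h2 : Homog 2 fun x => x 0 * newton x ^ 3 := by
      intro c hc x
      simp only [homog_newton c hc x, PiLp.smul_apply, smul_eq_mul]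
      field_simp
    have h3 : ∫ ω : Metric.sphere (0 : E3) 1, (ω : E3) 0 * newton ω ^ 3 ∂sphereMeasure = 0 :=
      integral_sphere_eq_zero_of_odd (f := fun x => x 0 * newton x ^ 3) fun x => by
        simp [newton_neg]
    have h4 : ∫ ω : Metric.sphere (0 : E3) 1, 2 * A * newton ω ^ 2 ∂sphereMeasure =
        2 * A * sphereArea := by
      simp [newton, sphereArea, mul_comm]
    rw [sphereIntegral_congr hR₀ hρ e0, sphereIntegral_add hR₀ hρ (hc1.fun_add hc2) hc3,
      sphereIntegral_add hR₀ hρ hc1 hc2, sphereIntegral_eq_of_homogeneous h1 hρ0,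
      sphereIntegral_eq_of_homogeneous h2 hρ0, h3, h4]
    field_simp
    ring
  obtain ⟨C, R, -, hC⟩ := sphereIntegral_bound hrem
  have hlim : Tendsto
      (sphereIntegral fun x => energyForm (dg g) x - energyForm (modelOne A) x) atTop (𝓝 0) := by
    have h0 : Tendsto (fun ρ : ℝ => C * ρ ^ (-q)) atTop (𝓝 0) := by
      simpa using (tendsto_rpow_neg_atTop hq).const_mul C
    refine squeeze_zero_norm' ?_ h0
    filter_upwards [eventually_gt_atTop R] with ρ hρ
    have := hC ρ hρ
    rwa [show 2 - (2 + q) = -q by ring] at this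
  unfold HasEnergy
  refine Tendsto.const_mul _ ?_
  have h5 := hlim.const_add (2 * A * sphereArea)
  rw [add_zero] at h5
  refine h5.congr' ?_
  filter_upwards [eventually_gt_atTop R₀] with ρ hρ
  exact (hsplit ρ hρ).symm

/-! ### The center of mass -/

/-- The vector field whose flux is the surface integral in the first component of the center of
mass. -/
def centerField (g : E3 → Matrix (Fin 3) (Fin 3) ℝ) (j : Fin 3) (x : E3) : ℝ :=
  x 0 * ∑ i, (dg g x i i j - dg g x j i i) - (g x j 0 - kd 0 j * ∑ i, g x i i)

lemma centerDensity_eq : centerDensity g 0 = fun x => ∑ j, centerField g j x * (x j / ‖x‖) := by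
  ext x
  simp only [centerDensity, centerField, energyDensity, dg, Fin.sum_univ_three, kd]
  simp
  ring

lemma contDiffOn_centerField (hg : IsRiemannianMetricOn g (exterior R₀)) (j : Fin 3) :
    ContDiffOn ℝ 1 (centerField g j) (exterior R₀) := by
  have h1 : ContDiffOn ℝ 1 (fun x : E3 => x 0) (exterior R₀) := by fun_prop
  have h2 : ∀ i j, ContDiffOn ℝ 1 (fun x => g x i j) (exterior R₀) := fun i j =>
    (hg.contDiffOn i j).of_le one_le_two
  exact (h1.mul (ContDiffOn.sum fun i _ => (hg.contDiffOn_pd i j i).sub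
    (hg.contDiffOn_pd i i j))).sub ((h2 j 0).sub (contDiffOn_const.mul
    (ContDiffOn.sum fun i _ => h2 i i)))

/-- With `Uⱼ = ∑ᵢ (∂ᵢ gᵢⱼ - ∂ⱼ gᵢᵢ)`, the divergence of `x₁ U` is `x₁ div U + U₁`. The zeroth-order
terms of the field are there to cancel `U₁`. -/
lemma div_centerField (hg : IsRiemannianMetricOn g (exterior R₀)) {x : E3}
    (hx : x ∈ exterior R₀) : ∑ j, pd j (centerField g j) x = x 0 * linScalar (ddg g x) := by
  have hd := hg.differentiableAt hx
  have hdd := hg.differentiableAt_pd hx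
  have h1 : ∀ j, pd j (centerField g j) x =
      x 0 * ∑ i, (ddg g x j i i j - ddg g x j j i i) +
      kd 0 j * ∑ i, (dg g x i i j - dg g x j i i) -
      (dg g x j j 0 - kd 0 j * ∑ i, dg g x j i i) := by
    intro j
    have hs : ∀ i ∈ Finset.univ, DifferentiableAt ℝ
        (fun y => pd i (fun z => g z i j) y - pd j (fun z => g z i i) y) x :=
      fun i _ => (hdd i j i).fun_sub (hdd i i j)
    have ht : DifferentiableAt ℝ (fun y => ∑ i, g y i i) x :=
      DifferentiableAt.fun_sum fun i _ => hd i i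
    have e : centerField g j = fun y =>
        y 0 * ∑ i, (pd i (fun z => g z i j) y - pd j (fun z => g z i i) y) -
        (g y j 0 - kd 0 j * ∑ i, g y i i) := rfl
    rw [e, pd_sub ((differentiableAt_coord 0 x).fun_mul (DifferentiableAt.fun_sum hs))
        ((hd j 0).fun_sub (ht.const_mul _)),
      pd_mul (differentiableAt_coord 0 x) (DifferentiableAt.fun_sum hs), pd_sum hs,
      pd_sub (hd j 0) (ht.const_mul _), pd_const_mul ht, pd_sum fun i _ => hd i i, pd_coord]
    have e2 : ∀ i, pd j (fun y => pd i (fun z => g z i j) y - pd j (fun z => g z i i) y) x =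
        ddg g x j i i j - ddg g x j j i i := fun i => pd_sub (hdd i j i) (hdd i i j) j
    simp only [e2, dg]
    ring
  simp only [h1, linScalar, Fin.sum_univ_three, kd]
  simp
  ring

lemma continuousOn_linScalar (hg : IsRiemannianMetricOn g (exterior R₀)) :
    ContinuousOn (fun x => linScalar (ddg g x)) (exterior R₀) := by
  have h : ∀ m k i j, ContinuousOn (fun x => ddg g x m k i j) (exterior R₀) := fun m k i j =>
    continuousOn_pd (hg.contDiffOn_pd i j k) m
  exact continuousOn_finsetSum _ fun j _ => continuousOn_finsetSum _ fun i _ =>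
    (h j i i j).sub (h j j i i)

lemma Dec.comp_neg {a : ℝ} {f : E3 → ℝ} (hf : Dec a f) : Dec a fun x => f (-x) := by
  obtain ⟨C, R, -, -, hC⟩ := hf.exists_bound
  refine dec_of_bound (C := C) (R := R) fun x hx => ?_
  simpa using hC (-x) (by simpa using hx)

/-- The second moment `∫ ω₁² dω` of the unit sphere. -/
def sphereMoment : ℝ := ∫ ω : Metric.sphere (0 : E3) 1, (ω : E3) 0 ^ 2 ∂sphereMeasure

lemma sphereMoment_pos : 0 < sphereMoment := by
  have hc : Continuous fun ω : Metric.sphere (0 : E3) 1 => (ω : E3) 0 ^ 2 := by fun_prop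
  -- The integrand is nonnegative, continuous and equal to `1` at the first basis vector.
  refine hc.integral_pos_of_hasCompactSupport_nonneg_nonzero
    (x := ⟨EuclideanSpace.single 0 1, by simp⟩) (HasCompactSupport.of_compactSpace _)
    (fun ω => sq_nonneg _) (by simp)

/-- If the scalar curvature vanishes, then the odd part of its linear part is given by the
interaction of `A / r` with `σ`. -/
lemma dec_linScalar_sub_neg (hq : 0 ≤ q) (hq1 : q ≤ 1)
    (hg : IsRiemannianMetricOn g (exterior R₀))
    (hR : ∀ x ∈ exterior R₀, scalarCurvature g x = 0)
    (hA : MetricApprox q g (modelZero A) (modelOne A) (modelTwo A)) :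
    Dec (4 + q) fun x => linScalar (ddg g x) - linScalar (ddg g (-x)) +
      3 * A * x 0 * newton x ^ 5 := by
  have h1 := hA.scalarCurvature hq hq1 hg
  -- Subtracting the expansion at `x` from the one at `-x` leaves the odd parts of `L` and of the
  -- quadratic terms, the curvature itself being zero at both points.
  refine (h1.comp_neg.sub h1).congr ?_
  filter_upwards [eventually_lt_norm R₀, eventually_lt_norm 0] with x hx hx0
  rw [hR x hx, hR (-x) (by simpa [exterior] using hx),
    ← quadModel_model_sub_neg A (norm_pos_iff.1 hx0)]
  ring

/-- The derivative of the flux integral is `-(3 / 2) A κ / ρ` up to `O(ρ^{-1-q})`. -/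
lemma exists_bound_deriv_center (hR₀ : 0 < R₀) (hq : 0 ≤ q) (hq1 : q ≤ 1)
    (hg : IsRiemannianMetricOn g (exterior R₀))
    (hR : ∀ x ∈ exterior R₀, scalarCurvature g x = 0)
    (hA : MetricApprox q g (modelZero A) (modelOne A) (modelTwo A)) :
    ∃ C R : ℝ, R₀ ≤ R ∧ ∀ ρ, R < ρ → ∃ D,
      HasDerivAt (sphereIntegral (centerDensity g 0)) D ρ ∧
      |D + (3 / 2) * A * sphereMoment / ρ| ≤ C * ρ ^ (-1 - q) := by
  have hL := continuousOn_linScalar hg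
  have hLn : ContinuousOn (fun x => linScalar (ddg g (-x))) (exterior R₀) :=
    hL.comp (f := fun x : E3 => -x) continuousOn_neg fun x hx => by simpa [exterior] using hx
  have hx0 := continuousOn_coord 0 (exterior R₀)
  have hn := continuousOn_newton hR₀
  have hdec := ((dec_coord 0).mul (dec_linScalar_sub_neg hq hq1 hg hR hA)).const_mul (1 / 2)
  obtain ⟨C, R, -, hC⟩ := sphereIntegral_bound hdec
  refine ⟨C, max R R₀, le_max_right _ _, fun ρ hρ =>
    ⟨sphereIntegral (fun x => x 0 * linScalar (ddg g x)) ρ, ?_, ?_⟩⟩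
  · have hρR : R₀ < ρ := (le_max_right _ _).trans_lt hρ
    rw [centerDensity_eq, sphereIntegral_congr hR₀ hρR fun x hx => (div_centerField hg hx).symm]
    exact hasDerivAt_flux hR₀ hρR (contDiffOn_centerField hg)
  · have hρR : R₀ < ρ := (le_max_right _ _).trans_lt hρ
    have hρ0 : 0 < ρ := hR₀.trans hρR
    -- Averaging over antipodal points replaces `x₁ L(x)` by `½ x₁ (L(x) - L(-x))`, to which the
    -- decay in `hdec` applies. The added term is homogeneous of degree `-3` and integrates to
    -- `(3/2) A κ / ρ`.
    have h1 := sphereIntegral_comp_neg (fun x => x 0 * linScalar (ddg g x)) ρ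
    have h2 : sphereIntegral (fun x => (1 / 2) * (x 0 * (linScalar (ddg g x) -
        linScalar (ddg g (-x)) + 3 * A * x 0 * newton x ^ 5))) ρ =
        sphereIntegral (fun x => (1 / 2) * (x 0 * linScalar (ddg g x))) ρ +
        sphereIntegral (fun x => (1 / 2) * ((-x) 0 * linScalar (ddg g (-x)))) ρ +
        sphereIntegral (fun x => (3 / 2 * A) * (x 0 ^ 2 * newton x ^ 5)) ρ := by
      have c1 : ContinuousOn (fun x => (1 / 2) * (x 0 * linScalar (ddg g x))) (exterior R₀) :=
        continuousOn_const.mul (hx0.mul hL)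
      have c2 : ContinuousOn (fun x => (1 / 2) * ((-x) 0 * linScalar (ddg g (-x))))
          (exterior R₀) := continuousOn_const.mul (hx0.neg.mul hLn)
      have c3 : ContinuousOn (fun x => (3 / 2 * A) * (x 0 ^ 2 * newton x ^ 5)) (exterior R₀) :=
        continuousOn_const.mul ((hx0.pow 2).mul (hn.pow 5))
      rw [← sphereIntegral_add hR₀ hρR c1 c2, ← sphereIntegral_add hR₀ hρR (c1.fun_add c2) c3]
      refine sphereIntegral_congr hR₀ hρR fun x _ => ?_
      simp only [PiLp.neg_apply]
      ring
    have h3 : Homog 3 fun x => x 0 ^ 2 * newton x ^ 5 := by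
      intro c hc x
      simp only [homog_newton c hc x, PiLp.smul_apply, smul_eq_mul]
      field_simp
    have h4 : ∫ ω : Metric.sphere (0 : E3) 1, (ω : E3) 0 ^ 2 * newton ω ^ 5 ∂sphereMeasure =
        sphereMoment := by
      simp [newton, sphereMoment]
    have h5 := hC ρ ((le_max_left _ _).trans_lt hρ)
    rw [show 2 - (-1 + (4 + q)) = -1 - q by ring, h2] at h5
    simp only [sphereIntegral_const_mul, h1, sphereIntegral_eq_of_homogeneous h3 hρ0, h4] at h5
    refine le_trans (le_of_eq ?_) h5
    congr 1
    field_simp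
    ring

/-- A function with derivative `-c / ρ + O(ρ^{-1-q})`, `c > 0`, tends to `-∞`. -/
lemma tendsto_atBot_of_deriv {T : ℝ → ℝ} {c C R : ℝ} (hc : 0 < c) (hq : 0 < q)
    (hT : ∀ ρ, R < ρ → ∃ D, HasDerivAt T D ρ ∧ |D + c / ρ| ≤ C * ρ ^ (-1 - q)) :
    Tendsto T atTop atBot := by
  have h0 : Tendsto (fun ρ : ℝ => C * ρ ^ (-q)) atTop (𝓝 0) := by
    simpa using (tendsto_rpow_neg_atTop hq).const_mul C
  obtain ⟨R₁, hR₁⟩ := ((h0.eventually (gt_mem_nhds (half_pos hc))).and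
    ((eventually_gt_atTop R).and (eventually_gt_atTop 0))).exists_forall_of_atTop
  -- Far out, the error uses up at most half of the slope `-c/ρ`. The other half makes `T + (c/2)
  -- log ρ` decreasing.
  have hder : ∀ ρ, R₁ ≤ ρ → ∃ D, HasDerivAt (fun ρ => T ρ + c / 2 * Real.log ρ) D ρ ∧ D ≤ 0 := by
    intro ρ hρ
    obtain ⟨h1, h2, h3⟩ := hR₁ ρ hρ
    obtain ⟨D, hD, hb⟩ := hT ρ h2
    refine ⟨_, hD.add ((Real.hasDerivAt_log h3.ne').const_mul (c / 2)), ?_⟩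
    have h4 : ρ ^ (-1 - q) = ρ ^ (-q) * ρ⁻¹ := by
      rw [← Real.rpow_neg_one ρ, ← Real.rpow_add h3]
      congr 1
      ring
    have h5 := (abs_le.1 hb).2
    have h6 : C * ρ ^ (-1 - q) ≤ c / 2 * ρ⁻¹ := by
      rw [h4, ← mul_assoc]
      exact mul_le_mul_of_nonneg_right h1.le (by positivity)
    rw [div_eq_mul_inv] at h5
    linarith
  have hanti : AntitoneOn (fun ρ => T ρ + c / 2 * Real.log ρ) (Set.Ici R₁) := by
    refine antitoneOn_of_deriv_nonpos (convex_Ici R₁) (fun ρ hρ => ?_) (fun ρ hρ => ?_)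
      fun ρ hρ => ?_
    · obtain ⟨D, hD, -⟩ := hder ρ hρ
      exact hD.continuousAt.continuousWithinAt
    · obtain ⟨D, hD, -⟩ := hder ρ (interior_subset hρ)
      exact hD.differentiableAt.differentiableWithinAt
    · obtain ⟨D, hD, h⟩ := hder ρ (interior_subset hρ)
      rwa [hD.deriv]
  have hlog : Tendsto (fun ρ => (T R₁ + c / 2 * Real.log R₁) + -(c / 2 * Real.log ρ)) atTop atBot :=
    tendsto_atBot_add_const_left _ _
      (tendsto_neg_atTop_atBot.comp (Real.tendsto_log_atTop.const_mul_atTop (half_pos hc)))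
  refine tendsto_atBot_mono' _ ?_ hlog
  filter_upwards [eventually_ge_atTop R₁] with ρ hρ
  have := hanti Set.self_mem_Ici hρ hρ
  simp only at this
  linarith

end AsymptoticallyFlat

end

theorem mainTheorem6 (R₀ : ℝ) (hR₀ : 0 < R₀) (q : ℝ) (hq : 1 / 2 < q) (hq' : q < 1) (A : ℝ)
    (g : AsymptoticallyFlat.E3 → Matrix (Fin 3) (Fin 3) ℝ)
    (hg : AsymptoticallyFlat.IsRiemannianMetricOn g (AsymptoticallyFlat.exterior R₀))
    (hR : ∀ x ∈ AsymptoticallyFlat.exterior R₀, AsymptoticallyFlat.scalarCurvature g x = 0)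
    (hasymp : AsymptoticallyFlat.HasAsymptotics g A (fun x => x 0 / ‖x‖) q) :
    ∃ E : ℝ, AsymptoticallyFlat.HasEnergy g E ∧
      (E ≠ 0 → AsymptoticallyFlat.HasCenterOfMass g E 0 ⊥) := by
  open AsymptoticallyFlat in
  have hq0 : 0 < q := by linarith
  have hA := metricApprox hR₀ hg hasymp
  refine ⟨_, hasEnergy_of_asymptotics hR₀ hq0 hg hA, fun hE => ?_⟩
  -- The energy is a multiple of `A`.
  have hA0 : A ≠ 0 := by
    rintro rfl
    simp at hE
  obtain ⟨C, R, -, hC⟩ := exists_bound_deriv_center hR₀ hq0.le hq'.le hg hR hA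
  have hm := sphereArea_pos
  have hκ := sphereMoment_pos
  unfold HasCenterOfMass
  rw [EReal.tendsto_coe_nhds_bot_iff]
  set K : ℝ := 1 / (16 * Real.pi * (1 / (16 * Real.pi) * (2 * A * sphereArea))) with hK
  have hK' : K = 1 / (2 * A * sphereArea) := by
    rw [hK]
    field_simp
  -- The slope is `K · (3/2) A κ` with `K = 1 / (2 A · area)`. The factor `A` cancels, so `c` is
  -- positive whatever the sign of `A`.
  refine tendsto_atBot_of_deriv (c := 3 * sphereMoment / (4 * sphereArea)) (C := |K| * C) (R := R)
    (by positivity) hq0 fun ρ hρ => ?_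
  obtain ⟨D, hD, hb⟩ := hC ρ hρ
  refine ⟨K * D, hD.const_mul K, ?_⟩
  have h1 : K * D + 3 * sphereMoment / (4 * sphereArea) / ρ =
      K * (D + 3 / 2 * A * sphereMoment / ρ) := by
    rw [hK', mul_add]
    congr 1
    field_simp
    ring
  rw [h1, abs_mul, mul_assoc |K|]
  exact mul_le_mul_of_nonneg_left hb (abs_nonneg K)
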